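/- Setting. Let $D_0$ be a finite nonempty set and $K\ge 1$. A reward $f$ on $D_0$ is drawn from a Gaussian process with mean zero and known kernel $k_0$ with $k_0(x,x)=1$. The domain is $D=D_0\times\{1,\dots,K\}$, with $|D|\ge 2$, and $f(x,k)=f(x)$: querying $(x,k)$ returns $f(x)$ plus independent $N(0,\sigma^2(k))$ noise and costs $c(k)$, where $\sigma^2(k)>0$ and $c(k)>0$. Let $\mu_t,\sigma_t^2$ be the posterior mean and variance on $D$ after $t$ queries, and $\sigma^2_{t|S}$ the posterior variance after additionally querying the points of a finite collection $S$ (repetitions allowed). Assume that $S\mapsto \sigma_t^2(z)-\sigma_{t|S}^2(z)$ is submodular for all $z\in D$, all $t$ and all first $t$ queries. Algorithm (TruVaR). Parameters: $\overline\delta>0$, $\beta_{(i)}>0$ and $\eta_{(i)}=2^{-(i-1)}$ for $i\ge1$. The task is either Bayesian optimization (BO) or level-set estimation (LSE) with threshold $h$. Start with $i=1$, $M_0=D$, $H_0=L_0=\emptyset$. At time $t=1,2,\dots$ query an $$x_t\in\arg\max_{x\in D}\frac{1}{c(x)}\sum_{z\in M_{t-1}}\Big(\max\{\beta_{(i)}\sigma_{t-1}^2(z),\eta_{(i)}^2\}-\max\{\beta_{(i)}\sigma_{t-1|x}^2(z),\eta_{(i)}^2\}\Big),$$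 where $c((x_0,k))=c(k)$ and ties are broken by any rule that uses only past observations. With $u_t,\ell_t=\mu_t\pm\beta_{(i)}^{1/2}\sigma_t$, set $M_t=\{x\in M_{t-1}:u_t(x)\ge\max_{z\in M_{t-1}}\ell_t(z)\}$ (BO), or $M_t=\{x\in M_{t-1}:\ell_t(x)\le h\le u_t(x)\}$, $H_t=H_{t-1}\cup\{x\in M_{t-1}:\ell_t(x)>h\}$, $L_t=L_{t-1}\cup\{x\in M_{t-1}:u_t(x)<h\}$ (LSE). Then, while $M_t\ne\emptyset$ and $\max_{x\in M_t}\beta_{(i)}^{1/2}\sigma_t(x)\le(1+\overline\delta)\eta_{(i)}$, increase $i$ by one. The cumulative cost is $C_t=\sum_{t'\le t}c(x_{t'})$. The state at time $t$ is $\epsilon$-accurate if, for BO, $M_t$ contains all maximizers $x^*$ of $f$ and $f(x^*)-f(x)\le\epsilon$ for all $x\in M_t$; for LSE, if $f>h$ on $H_t$, $f<h$ on $L_t$, and $|f-h|\le\epsilon/2$ on $M_t$. Bound. Let $c_{\min}=\min_k c(k)$ and $c_{\max}=\max_k c(k)$. Fix $\delta\in(0,1)$ and $\epsilon>0$ with $\max\{1,\overline\delta\}\,\epsilon\le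 4(1+\overline\delta)$. Let $\beta_T=2\log\frac{|D|T^2c_{\max}^2\pi^2}{6\delta c_{\min}^2}$, let $\gamma_T(\sigma^2)=\max_{x_1,\dots,x_T\in D_0}\frac12\log\det(I_T+\sigma^{-2}[k_0(x_i,x_j)]_{i,j})$, and let $T^*(k)$ be the smallest integer $T\ge1$ such that, with $\sigma^2=\sigma^2(k)$ and $\gamma_T=\gamma_T(\sigma^2(k))$, $$T\ge\Big(2\sigma^2\gamma_T\beta_T\frac{96(1+\overline\delta)^2}{\epsilon^2}+\frac{\gamma_T\beta_T}{\log(1+\sigma^{-2})}\cdot\frac{6(1+\overline\delta)^2}{\sigma^2}+2\max\Big\{0,\Big\lceil\log_2\frac{32(1+\overline\delta)^2}{\epsilon\sigma}\Big\rceil\Big\}\Big)\log\frac{16(1+\overline\delta)^2|D|\beta_T}{\overline\delta^2\epsilon^2}.$$ Corollary 3. There are choices of $\beta_{(i)}$, bounded below by a positive constant and fixed in advance (they depend neither on time nor on the task, the reward or the observations), such that, for each task, with probability at least $1-\delta$ the state is $\epsilon$-accurate at every time $t$ with $C_t\ge\min_k c(k)T^*(k)$. -/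

import Mathlib

open MeasureTheory ProbabilityTheory

namespace TruVaR

noncomputable section

/-! ### Gaussian process posterior -/

section Posterior

variable {D : Type*}

/-- The matrix `K + Σ` of a list of query points: kernel matrix plus diagonal noise. -/
def noisyGram (k : D → D → ℝ) (noiseVar : D → ℝ) (l : List D) :
    Matrix (Fin l.length) (Fin l.length) ℝ :=
  Matrix.of (fun i j => k (l.get i) (l.get j)) + Matrix.diagonal (fun i => noiseVar (l.get i))

/-- The vector of covariances between the queried points and `x`. -/
def kernelVec (k : D → D → ℝ) (l : List D) (x : D) : Fin l.length → ℝ :=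
  fun i => k (l.get i) x

/-- Posterior mean at `x`, when the `i`-th point of `l` produced the observation `y i`. -/
def postMean (k : D → D → ℝ) (noiseVar : D → ℝ) (l : List D) (y : ℕ → ℝ) (x : D) : ℝ :=
  kernelVec k l x ⬝ᵥ ((noisyGram k noiseVar l)⁻¹.mulVec (fun i => y i))

/-- Posterior variance at `x` after observing the points of `l`. -/
def postVar (k : D → D → ℝ) (noiseVar : D → ℝ) (l : List D) (x : D) : ℝ :=
  k x x - kernelVec k l x ⬝ᵥ ((noisyGram k noiseVar l)⁻¹.mulVec (kernelVec k l x))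

/-- Posterior standard deviation. -/
def postStd (k : D → D → ℝ) (noiseVar : D → ℝ) (l : List D) (x : D) : ℝ :=
  √(postVar k noiseVar l x)

/-- Variance reduction at `x` from observing the points of `S` in addition to those of `past`. -/
def varReduction (k : D → D → ℝ) (noiseVar : D → ℝ) (past : List D) (x : D) (S : List D) : ℝ :=
  postVar k noiseVar past x - postVar k noiseVar (past ++ S) x

/-- Submodularity (diminishing returns) of the variance reduction, as a function of a collection
of points with duplicates allowed, for all past points and all target points `x`.
`S.Subperm S'` is inclusion of multisets. -/
def SubmodularVarReduction (k : D → D → ℝ) (noiseVar : D → ℝ) : Prop :=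
  ∀ (past : List D) (x : D) (S S' : List D), S.Subperm S' → ∀ p : D,
    varReduction k noiseVar past x (S' ++ [p]) - varReduction k noiseVar past x S' ≤
      varReduction k noiseVar past x (S ++ [p]) - varReduction k noiseVar past x S

end Posterior

/-! ### The algorithm -/

/-- The two problems: Bayesian optimization, or level-set estimation with threshold `h`. -/
inductive Task where
  | bo : Task
  | lse (h : ℝ) : Task

/-- The input of the algorithm. Epochs are numbered from `0`, so that `β i` and
`η₁ * r ^ i` are the parameters of the `(i+1)`-st epoch. -/
structure Input (D : Type*) where
  /-- the kernel -/
  kernel : D → D → ℝ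
  /-- the noise variance of each point -/
  noiseVar : D → ℝ
  /-- the cost of each point -/
  cost : D → ℝ
  /-- the problem to solve -/
  task : Task
  /-- slack in the end-of-epoch test -/
  δbar : ℝ
  /-- factor by which the target confidence shrinks -/
  r : ℝ
  /-- target confidence of the first epoch -/
  η₁ : ℝ
  /-- squared confidence widths -/
  β : ℕ → ℝ

/-- The state of the algorithm after a time step: current epoch, and the sets `M`, `H`, `L`. -/
structure State (D : Type*) where
  /-- current epoch -/
  epoch : ℕ
  /-- potential maximizers, or unclassified points -/
  M : Finset D
  /-- points classified as above the threshold -/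
  H : Finset D
  /-- points classified as below the threshold -/
  L : Finset D

namespace Input

variable {D : Type*} (A : Input D)

/-- Target confidence of an epoch. -/
def η (i : ℕ) : ℝ := A.η₁ * A.r ^ i

/-- Upper confidence bound with the parameter of epoch `i`. -/
def ucb (i : ℕ) (l : List D) (y : ℕ → ℝ) (x : D) : ℝ :=
  postMean A.kernel A.noiseVar l y x + √(A.β i) * postStd A.kernel A.noiseVar l x

/-- Lower confidence bound with the parameter of epoch `i`. -/
def lcb (i : ℕ) (l : List D) (y : ℕ → ℝ) (x : D) : ℝ :=
  postMean A.kernel A.noiseVar l y x - √(A.β i) * postStd A.kernel A.noiseVar l x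

/-- The acquisition function: decrease of the truncated variances over `M`, per unit cost, from
querying `x` after the points of `l`. -/
def acquisition (i : ℕ) (M : Finset D) (l : List D) (x : D) : ℝ :=
  (∑ z ∈ M, max (A.β i * postVar A.kernel A.noiseVar l z) (A.η i ^ 2) -
    ∑ z ∈ M, max (A.β i * postVar A.kernel A.noiseVar (l ++ [x]) z) (A.η i ^ 2)) / A.cost x

/-- The test for ending epoch `i`: the confidence of all points of `M` is at most
`(1 + δbar) * η i`. -/
def EpochDone (i : ℕ) (M : Finset D) (l : List D) : Prop :=
  ∀ x ∈ M, √(A.β i) * postStd A.kernel A.noiseVar l x ≤ (1 + A.δbar) * A.η i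

open Classical in
/-- The while loop: starting from epoch `i`, move to the first epoch whose test fails.
(If there is none, which includes the case that `M` is empty and nothing is left to be done,
the epoch is kept.) -/
def nextEpoch (i : ℕ) (M : Finset D) (l : List D) : ℕ :=
  if h : ∃ j, i ≤ j ∧ ¬ A.EpochDone j M l then Nat.find h else i

open Classical in
/-- One update of the state, where `l` and `y` are all points and observations so far. -/
def update (s : State D) (l : List D) (y : ℕ → ℝ) : State D :=
  let u := A.ucb s.epoch l y
  let ℓ := A.lcb s.epoch l y
  match A.task with
  | Task.bo =>
      let M' := s.M.filter (fun x => ∀ z ∈ s.M, ℓ z ≤ u x)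
      { epoch := A.nextEpoch s.epoch M' l, M := M', H := s.H, L := s.L }
  | Task.lse h =>
      let M' := s.M.filter (fun x => h ≤ u x ∧ ℓ x ≤ h)
      { epoch := A.nextEpoch s.epoch M' l
        M := M'
        H := s.H ∪ s.M.filter (fun x => h < ℓ x)
        L := s.L ∪ s.M.filter (fun x => u x < h) }

end Input

/-- The first `t` query points. The `(t+1)`-st point queried is `x t`. -/
def history {D : Type*} (x : ℕ → D) (t : ℕ) : List D := (List.range t).map x

/-- The state after `t` time steps, given the sequences of queries and of observations
(of which only the first `t` terms matter). -/
def Input.state {D : Type*} [Fintype D] (A : Input D) (x : ℕ → D) (y : ℕ → ℝ) : ℕ → State D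
  | 0 => { epoch := 0, M := Finset.univ, H := ∅, L := ∅ }
  | t + 1 => A.update (Input.state A x y t) (history x (t + 1)) y

/-- The selection rule: every query maximizes the acquisition function over the whole domain. -/
def Input.GreedySelection {D : Type*} [Fintype D] (A : Input D) (x : ℕ → D) (y : ℕ → ℝ) : Prop :=
  ∀ (t : ℕ) (x' : D),
    A.acquisition (A.state x y t).epoch (A.state x y t).M (history x t) x' ≤
      A.acquisition (A.state x y t).epoch (A.state x y t).M (history x t) (x t)

/-- Cumulative cost after `t` time steps. -/
def cumCost {D : Type*} (cost : D → ℝ) (x : ℕ → D) (t : ℕ) : ℝ :=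
  ∑ i ∈ Finset.range t, cost (x i)

/-- `ε`-accuracy of a state with respect to the reward function `f`. -/
def EpsAccurate {D : Type*} (f : D → ℝ) (ε : ℝ) (s : State D) : Task → Prop
  | Task.bo =>
      (∀ x, (∀ z, f z ≤ f x) → x ∈ s.M) ∧ (∀ x ∈ s.M, ∀ z, (∀ w, f w ≤ f z) → f z - f x ≤ ε)
  | Task.lse h =>
      (∀ x ∈ s.H, h < f x) ∧ (∀ x ∈ s.L, f x < h) ∧ (∀ x ∈ s.M, |f x - h| ≤ ε / 2)

/-! ### The probabilistic model -/

section Model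

variable {D : Type*} {Ω : Type*} [MeasurableSpace Ω]

/-- `f` is a Gaussian process with mean zero and covariance function `k`. -/
structure IsCenteredGP (k : D → D → ℝ) (f : D → Ω → ℝ) (P : Measure Ω) : Prop where
  measurable : ∀ x, Measurable (f x)
  gaussian : IsGaussianProcess f P
  mean_zero : ∀ x, ∫ ω, f x ω ∂P = 0
  covariance : ∀ x x', cov[f x, f x'; P] = k x x'

/-- `w` is a sequence of independent standard Gaussians, independent of the function `f`. -/
structure IsStdNoise {E : Type*} (w : ℕ → Ω → ℝ) (f : E → Ω → ℝ) (P : Measure Ω) : Prop where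
  measurable : ∀ t, Measurable (w t)
  gaussian : ∀ t, P.map (w t) = gaussianReal 0 1
  indep : iIndepFun w P
  indep_f : IndepFun (fun ω t => w t ω) (fun ω x => f x ω) P

/-- `x`, `y` are the queries and observations of a run of the algorithm on the reward `f`:
the observation at time `t` is `f (x t)` plus Gaussian noise of variance `noiseVar (x t)`; each
query maximizes the acquisition function; and it is determined by the previous observations (so
ties between maximizers may be broken in any way that uses only these). -/
structure IsRun [Fintype D] (A : Input D) (f : D → Ω → ℝ) (w : ℕ → Ω → ℝ)
    (x : ℕ → Ω → D) (y : ℕ → Ω → ℝ) : Prop where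
  observation : ∀ t ω, y t ω = f (x t ω) ω + √(A.noiseVar (x t ω)) * w t ω
  greedy : ∀ ω, A.GreedySelection (fun t => x t ω) (fun t => y t ω)
  causal : ∀ t d,
    MeasurableSet[⨆ s : Fin t, MeasurableSpace.comap (y s) inferInstance] {ω | x t ω = d}

end Model

/-- The algorithm's input when the noise level can be chosen: the domain is `D₀ × {1, …, K}`, the
reward and its kernel depend on the point of `D₀` only, and the noise variance and the cost depend
on the noise level only. The first target confidence is `1`, and it is halved between epochs. -/
def chooseNoiseInput {D₀ : Type*} {K : ℕ} (k₀ : D₀ → D₀ → ℝ) (σ2 c : Fin K → ℝ) (task : Task)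
    (δbar : ℝ) (β : ℕ → ℝ) : Input (D₀ × Fin K) where
  kernel p q := k₀ p.1 q.1
  noiseVar p := σ2 p.2
  cost p := c p.2
  task := task
  δbar := δbar
  r := 1 / 2
  η₁ := 1
  β := β

/-! ### The quantities in the bound -/

/-- Maximum mutual information of `T` observations with noise variance `σ2`. -/
def maxInfoGain {D₀ : Type*} (k : D₀ → D₀ → ℝ) (σ2 : ℝ) (T : ℕ) : ℝ :=
  ⨆ x : Fin T → D₀,
    1 / 2 * Real.log (1 + σ2⁻¹ • Matrix.of (fun i j => k (x i) (x j))).det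

/-- `2 log (N T² R² π² / (6 δ))`, where `N` is the size of the domain and `R` is the ratio of the
maximum cost to the minimum cost. -/
def betaT (N : ℕ) (R δ : ℝ) (T : ℕ) : ℝ :=
  2 * Real.log (N * (T : ℝ) ^ 2 * R ^ 2 * Real.pi ^ 2 / (6 * δ))

/-- The condition on the time horizon `T` for the noise variance `σ2`, the maximum mutual
information `γ` and the confidence parameter `β` (both at `T`), and the size `N` of the domain.
The rounded-up logarithm, a bound on a number of epochs, is read as `0` where it is negative:
`⌈·⌉₊` is the maximum of `0` and the ceiling. -/
def HorizonCondition (σ2 γ β δbar ε : ℝ) (N T : ℕ) : Prop :=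
  (2 * σ2 * γ * β * (96 * (1 + δbar) ^ 2 / ε ^ 2)
      + 1 / Real.log (1 + σ2⁻¹) * γ * β * (6 * (1 + δbar) ^ 2 / σ2)
      + 2 * (⌈Real.logb 2 (32 * (1 + δbar) ^ 2 / (ε * √σ2))⌉₊ : ℝ))
    * Real.log (16 * (1 + δbar) ^ 2 * N * β / (δbar ^ 2 * ε ^ 2)) ≤ T

/-- The smallest `T ≥ 1` such that the horizon condition holds with the noise variance `σ2`. -/
def minHorizon {D₀ : Type*} (k : D₀ → D₀ → ℝ) (N : ℕ) (R δ δbar ε σ2 : ℝ) : ℕ :=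
  sInf {T : ℕ | 1 ≤ T ∧
    HorizonCondition σ2 (maxInfoGain k σ2 T) (betaT N R δ T) δbar ε N T}

end

end TruVaR

/-!
The greedy rule buys excess posterior variance at the best rate per unit of cost. By submodularity,
a collection `S` of queries that brings every variance below the target of the current epoch
contains a point whose rate is at least `potential / cost S`, so the potential of the epoch decays
like `exp (-u / cost S)` in the cost `u` spent, and the epoch ends after a cost of `cost S` times a
logarithmic factor. Information gain bounds `cost S`: uncertainty sampling at a single noise level
lowers the largest variance to about `γ_T / T` in `T` queries.

An epoch that must end within a known cost, at a known lower bound on the cost per query, also ends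
by a known time. Hence its confidence parameter only has to be valid up to that time, where it
follows from Gaussian tails and a union bound over time and the domain. All epochs that matter
for the accuracy `ε` share the parameter `betaT`, valid up to the horizon `T*`, and the horizon
condition says that together they fit into the cost `c k * T*`. The parameters of the later epochs
are chosen one after the other, each large enough for the time its own budget allows; this is
possible because that time is polynomial in the parameter while the required width is logarithmic.
-/

namespace TruVaR

open Asymptotics Filter
open scoped NNReal ENNReal Matrix

/-! ### Posterior variances -/

section PosteriorVariance

variable {D : Type*} {k : D → D → ℝ} {noiseVar : D → ℝ}

theorem noisyGram_posDef (hk : (Matrix.of k).PosSemidef) (hn : ∀ x, 0 < noiseVar x) (l : List D) :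
    (noisyGram k noiseVar l).PosDef :=
  Matrix.PosDef.posSemidef_add (hk.submatrix l.get) (Matrix.PosDef.diagonal fun i => hn (l.get i))

theorem isUnit_det_noisyGram (hk : (Matrix.of k).PosSemidef) (hn : ∀ x, 0 < noiseVar x)
    (l : List D) : IsUnit (noisyGram k noiseVar l).det :=
  (noisyGram_posDef hk hn l).det_pos.ne'.isUnit

theorem noisyGram_transpose (hk : (Matrix.of k).PosSemidef) (l : List D) :
    (noisyGram k noiseVar l)ᵀ = noisyGram k noiseVar l := by
  have hsymm : ((Matrix.of k).submatrix l.get l.get)ᵀ = (Matrix.of k).submatrix l.get l.get := by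
    simpa using (hk.submatrix l.get).isHermitian.eq
  change (_ + Matrix.diagonal _)ᵀ = _ + Matrix.diagonal _
  rw [Matrix.transpose_add, Matrix.diagonal_transpose]
  exact congrArg (· + _) hsymm

theorem kernel_symm (hk : (Matrix.of k).PosSemidef) (x y : D) : k x y = k y x := by
  simpa using hk.isHermitian.apply y x

/-- The coefficients of the best linear predictor of the reward at `z` from noisy observations of
the points of `l`, which is the posterior mean. -/
noncomputable def predWeights (k : D → D → ℝ) (noiseVar : D → ℝ) (l : List D) (z : D) :
    Fin l.length → ℝ :=
  (noisyGram k noiseVar l)⁻¹ *ᵥ kernelVec k l z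

/-- The mean squared error of the linear predictor with coefficients `a` of the reward at `z`.
Its minimum over `a` is the posterior variance, which makes it the tool for bounding that. -/
noncomputable def predRisk (k : D → D → ℝ) (noiseVar : D → ℝ) (l : List D) (z : D)
    (a : Fin l.length → ℝ) : ℝ :=
  k z z - 2 * (a ⬝ᵥ kernelVec k l z) + a ⬝ᵥ noisyGram k noiseVar l *ᵥ a

theorem noisyGram_mulVec_predWeights (hk : (Matrix.of k).PosSemidef) (hn : ∀ x, 0 < noiseVar x)
    (l : List D) (z : D) :
    noisyGram k noiseVar l *ᵥ predWeights k noiseVar l z = kernelVec k l z := by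
  rw [predWeights, Matrix.mulVec_mulVec, Matrix.mul_nonsing_inv _ (isUnit_det_noisyGram hk hn l),
    Matrix.one_mulVec]

theorem predRisk_eq_postVar_add (hk : (Matrix.of k).PosSemidef) (hn : ∀ x, 0 < noiseVar x)
    (l : List D) (z : D) (a : Fin l.length → ℝ) :
    predRisk k noiseVar l z a = postVar k noiseVar l z +
      (a - predWeights k noiseVar l z) ⬝ᵥ
        noisyGram k noiseVar l *ᵥ (a - predWeights k noiseVar l z) := by
  have hG := noisyGram_mulVec_predWeights hk hn l z
  have hcross : predWeights k noiseVar l z ⬝ᵥ noisyGram k noiseVar l *ᵥ a =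
      a ⬝ᵥ kernelVec k l z := by
    rw [Matrix.dotProduct_mulVec, ← Matrix.mulVec_transpose, noisyGram_transpose hk, hG,
      dotProduct_comm]
  have hv : postVar k noiseVar l z = k z z - predWeights k noiseVar l z ⬝ᵥ kernelVec k l z := by
    rw [dotProduct_comm]; rfl
  rw [predRisk, hv, Matrix.mulVec_sub, dotProduct_sub, sub_dotProduct, sub_dotProduct, hG, hcross]
  ring

theorem predRisk_predWeights (hk : (Matrix.of k).PosSemidef) (hn : ∀ x, 0 < noiseVar x)
    (l : List D) (z : D) :
    predRisk k noiseVar l z (predWeights k noiseVar l z) = postVar k noiseVar l z := by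
  rw [predRisk_eq_postVar_add hk hn, sub_self, zero_dotProduct, add_zero]

theorem postVar_le_predRisk (hk : (Matrix.of k).PosSemidef) (hn : ∀ x, 0 < noiseVar x)
    (l : List D) (z : D) (a : Fin l.length → ℝ) :
    postVar k noiseVar l z ≤ predRisk k noiseVar l z a := by
  rw [predRisk_eq_postVar_add hk hn]
  exact le_add_of_nonneg_right <| by
    simpa using (noisyGram_posDef hk hn l).posSemidef.dotProduct_mulVec_nonneg
      (a - predWeights k noiseVar l z)

theorem postVar_le_prior (hk : (Matrix.of k).PosSemidef) (hn : ∀ x, 0 < noiseVar x)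
    (l : List D) (z : D) : postVar k noiseVar l z ≤ k z z := by
  simpa [predRisk] using postVar_le_predRisk hk hn l z 0

theorem postVar_nil (z : D) : postVar k noiseVar [] z = k z z := by
  simp [postVar, dotProduct]

theorem dotProduct_diagonal_le_predRisk (hk : (Matrix.of k).PosSemidef) (l : List D) (z : D)
    (a : Fin l.length → ℝ) :
    a ⬝ᵥ Matrix.diagonal (fun i => noiseVar (l.get i)) *ᵥ a ≤ predRisk k noiseVar l z a := by
  set v := kernelVec k l z
  have hblocks : (Matrix.of k).submatrix (Sum.elim l.get fun _ : Unit => z)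
      (Sum.elim l.get fun _ : Unit => z) =
      Matrix.fromBlocks ((Matrix.of k).submatrix l.get l.get) (Matrix.replicateCol Unit v)
        (Matrix.replicateRow Unit v) (Matrix.of fun _ _ => k z z) := by
    ext (_ | _) (_ | _) <;> simp [v, kernelVec, kernel_symm hk z]
  have hnonneg := (hk.submatrix (Sum.elim l.get fun _ : Unit => z)).dotProduct_mulVec_nonneg
    (Sum.elim a fun _ => -1)
  have hG : noisyGram k noiseVar l = (Matrix.of k).submatrix l.get l.get +
      Matrix.diagonal fun i => noiseVar (l.get i) := rfl
  rw [star_trivial, hblocks, Matrix.fromBlocks_mulVec, sumElim_dotProduct_sumElim] at hnonneg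
  have hcol : Matrix.replicateCol Unit v *ᵥ (fun _ => (-1 : ℝ)) = -v := by
    ext i; simp [Matrix.mulVec, dotProduct]
  simp only [Sum.elim_comp_inl, Sum.elim_comp_inr, hcol, dotProduct_add, dotProduct_neg] at hnonneg
  rw [predRisk, hG, Matrix.add_mulVec, dotProduct_add]
  have hrow : (fun _ : Unit => (-1 : ℝ)) ⬝ᵥ Matrix.replicateRow Unit v *ᵥ a = -(a ⬝ᵥ v) := by
    simp [Matrix.mulVec, dotProduct_comm a]
  have hcorner : (fun _ : Unit => (-1 : ℝ)) ⬝ᵥ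
      Matrix.of (fun _ _ : Unit => k z z) *ᵥ (fun _ => -1) = k z z := by
    simp [Matrix.mulVec]
  rw [hrow, hcorner] at hnonneg
  linarith

theorem postVar_pos (hk : (Matrix.of k).PosSemidef) (hn : ∀ x, 0 < noiseVar x)
    (l : List D) (z : D) (hz : 0 < k z z) : 0 < postVar k noiseVar l z := by
  rw [← predRisk_predWeights hk hn]
  generalize predWeights k noiseVar l z = a
  by_cases ha : a = 0
  · simpa [predRisk, ha] using hz
  · exact lt_of_lt_of_le
      (by simpa using (Matrix.PosDef.diagonal fun i => hn (l.get i)).dotProduct_mulVec_pos ha)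
      (dotProduct_diagonal_le_predRisk hk l z a)

theorem postVar_nonneg (hk : (Matrix.of k).PosSemidef) (hn : ∀ x, 0 < noiseVar x)
    (l : List D) (z : D) : 0 ≤ postVar k noiseVar l z := by
  rw [← predRisk_predWeights hk hn]
  exact le_trans (by simpa using (Matrix.PosDef.diagonal fun i =>
    hn (l.get i)).posSemidef.dotProduct_mulVec_nonneg _) (dotProduct_diagonal_le_predRisk hk l z _)

theorem dotProduct_extend_zero {m n : Type*} [Fintype m] [Fintype n] (e : m ↪ n) (a : m → ℝ)
    (v : n → ℝ) : Function.extend e a 0 ⬝ᵥ v = a ⬝ᵥ (v ∘ e) :=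
  (Fintype.sum_of_injective e e.injective _ _
    (fun j hj => by rw [Function.extend_apply' _ _ _ (by simpa using hj), Pi.zero_apply, zero_mul])
    (fun i => by rw [e.injective.extend_apply]; rfl)).symm

theorem predRisk_extend_zero {S l : List D} (e : Fin S.length ↪ Fin l.length)
    (he : ∀ i, S.get i = l.get (e i)) (z : D) (a : Fin S.length → ℝ) :
    predRisk k noiseVar l z (Function.extend e a 0) = predRisk k noiseVar S z a := by
  have hvec : kernelVec k l z ∘ e = kernelVec k S z := by
    ext i; simp only [Function.comp_apply, kernelVec, he]
  have hgram : (noisyGram k noiseVar l *ᵥ Function.extend e a 0) ∘ e =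
      noisyGram k noiseVar S *ᵥ a := by
    ext i
    simp only [Function.comp_apply, Matrix.mulVec]
    rw [dotProduct_comm, dotProduct_extend_zero, dotProduct_comm]
    congr 1
    ext j
    simp only [Function.comp_apply, noisyGram, Matrix.add_apply, Matrix.of_apply,
      Matrix.diagonal_apply, he, e.apply_eq_iff_eq]
  rw [predRisk, predRisk, dotProduct_extend_zero, dotProduct_extend_zero, hvec, hgram]

theorem postVar_le_of_sublist (hk : (Matrix.of k).PosSemidef) (hn : ∀ x, 0 < noiseVar x)
    {S l : List D} (h : S.Sublist l) (z : D) :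
    postVar k noiseVar l z ≤ postVar k noiseVar S z := by
  obtain ⟨e, he⟩ := List.sublist_iff_exists_fin_orderEmbedding_get_eq.1 h
  rw [← predRisk_predWeights hk hn S, ← predRisk_extend_zero e.toEmbedding he]
  exact postVar_le_predRisk hk hn l z _

theorem postVar_replicate_le (hk : (Matrix.of k).PosSemidef) (hn : ∀ x, 0 < noiseVar x)
    (n : ℕ) (z : D) :
    postVar k noiseVar (List.replicate n z) z ≤
      k z z * noiseVar z / (noiseVar z + n * k z z) := by
  have hz : 0 ≤ k z z := hk.diag_nonneg
  have hden : 0 < noiseVar z + n * k z z := add_pos_of_pos_of_nonneg (hn z) (by positivity)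
  refine (postVar_le_predRisk hk hn _ z fun _ => k z z / (noiseVar z + n * k z z)).trans_eq ?_
  have hvec : kernelVec k (List.replicate n z) z = fun _ => k z z := by
    ext i; simp [kernelVec]
  rw [predRisk, noisyGram, hvec, Matrix.add_mulVec, dotProduct_add]
  simp only [dotProduct, Matrix.mulVec, Matrix.diagonal_apply, Matrix.of_apply,
    List.get_eq_getElem, List.getElem_replicate, ite_mul, zero_mul, Finset.sum_const,
    Finset.sum_ite_eq, Finset.mem_univ, if_true, Finset.card_univ, Fintype.card_fin,
    List.length_replicate, nsmul_eq_mul]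
  obtain ⟨d, hd⟩ : ∃ d, d = noiseVar z + n * k z z := ⟨_, rfl⟩
  rw [← hd] at hden ⊢
  rw [eq_sub_of_add_eq hd.symm]
  field_simp
  ring

theorem postVar_le_of_count [DecidableEq D] (hk : (Matrix.of k).PosSemidef)
    (hn : ∀ x, 0 < noiseVar x) (l : List D) (z : D) :
    postVar k noiseVar l z ≤ k z z * noiseVar z / (noiseVar z + l.count z * k z z) :=
  (postVar_le_of_sublist hk hn (List.replicate_sublist_iff.2 le_rfl) z).trans
    (postVar_replicate_le hk hn _ z)

theorem det_noisyGram_append_singleton (hk : (Matrix.of k).PosSemidef)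
    (hn : ∀ x, 0 < noiseVar x) (l : List D) (x : D) :
    (noisyGram k noiseVar (l ++ [x])).det =
      (noisyGram k noiseVar l).det * (noiseVar x + postVar k noiseVar l x) := by
  let e : Fin l.length ⊕ Fin 1 ≃ Fin (l ++ [x]).length :=
    finSumFinEquiv.trans (finCongr (by simp))
  have hl (i : Fin l.length) : (l ++ [x]).get (e (Sum.inl i)) = l.get i := by simp [e]
  have hr (i : Fin 1) : (l ++ [x]).get (e (Sum.inr i)) = x := by simp [e]
  have hblocks : (noisyGram k noiseVar (l ++ [x])).submatrix e e =
      Matrix.fromBlocks (noisyGram k noiseVar l)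
        (Matrix.replicateCol (Fin 1) (kernelVec k l x))
        (Matrix.replicateRow (Fin 1) (kernelVec k l x))
        (Matrix.of fun _ _ => k x x + noiseVar x) := by
    ext (i | i) (j | j) <;>
      simp only [noisyGram, Matrix.submatrix_apply, Matrix.add_apply, Matrix.of_apply,
        Matrix.diagonal_apply, EmbeddingLike.apply_eq_iff_eq, hl, hr]
    · simp [Matrix.diagonal_apply]
    · simp [kernelVec]
    · simp [kernelVec, kernel_symm hk x]
    · simp [Subsingleton.elim i j]
  have := (noisyGram k noiseVar l).invertibleOfIsUnitDet (isUnit_det_noisyGram hk hn l)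
  rw [← Matrix.det_submatrix_equiv_self e, hblocks, Matrix.det_fromBlocks₁₁, Matrix.det_fin_one,
    Matrix.invOf_eq_nonsing_inv, Matrix.mul_assoc]
  congr 1
  change k x x + noiseVar x -
    kernelVec k l x ⬝ᵥ (noisyGram k noiseVar l)⁻¹ *ᵥ kernelVec k l x = _
  rw [postVar]
  ring

end PosteriorVariance

/-! ### Information gain -/

section InformationGain

variable {D : Type*} {k : D → D → ℝ} {noiseVar : D → ℝ}

/-- The determinant `det (I + v⁻¹ K)` of a list of query points. Half of its logarithm is the mutual
information between the reward and observations of these points with noise variance `v`. -/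
noncomputable def infoDet (k : D → D → ℝ) (v : ℝ) (l : List D) : ℝ :=
  (1 + v⁻¹ • Matrix.of (fun i j => k (l.get i) (l.get j)) :
    Matrix (Fin l.length) (Fin l.length) ℝ).det

theorem infoDet_nil (v : ℝ) : infoDet k v [] = 1 := by
  simp [infoDet]

theorem infoDet_ofFn (v : ℝ) {n : ℕ} (x : Fin n → D) :
    infoDet k v (List.ofFn x) =
      (1 + v⁻¹ • Matrix.of (fun i j => k (x i) (x j)) : Matrix (Fin n) (Fin n) ℝ).det := by
  rw [infoDet, ← Matrix.det_submatrix_equiv_self (finCongr (List.length_ofFn (f := x)))]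
  congr 1
  ext i j
  simp only [Matrix.submatrix_apply, Matrix.add_apply, Matrix.smul_apply, Matrix.of_apply,
    List.get_ofFn, Matrix.one_apply, Fin.cast_inj, finCongr_apply]

theorem det_noisyGram_eq_infoDet {v : ℝ} (hv : v ≠ 0) {l : List D}
    (hl : ∀ p ∈ l, noiseVar p = v) :
    (noisyGram k noiseVar l).det = v ^ l.length * infoDet k v l := by
  have hnoise : Matrix.diagonal (fun i => noiseVar (l.get i)) =
      v • (1 : Matrix (Fin l.length) (Fin l.length) ℝ) := by
    simp_rw [hl _ (List.get_mem l _), Matrix.smul_one_eq_diagonal]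
  have hscale : noisyGram k noiseVar l =
      v • (1 + v⁻¹ • Matrix.of fun i j => k (l.get i) (l.get j)) := by
    rw [noisyGram, hnoise, smul_add, smul_inv_smul₀ hv, add_comm]
  rw [hscale, Matrix.det_smul, Fintype.card_fin, infoDet]

theorem infoDet_pos (hk : (Matrix.of k).PosSemidef) {v : ℝ} (hv : 0 < v) (l : List D) :
    0 < infoDet k v l := by
  have h := (noisyGram_posDef (noiseVar := fun _ => v) hk (fun _ => hv) l).det_pos
  rw [det_noisyGram_eq_infoDet hv.ne' fun _ _ => rfl] at h
  exact (mul_pos_iff_of_pos_left (pow_pos hv _)).1 h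

theorem infoDet_append_singleton (hk : (Matrix.of k).PosSemidef) (hn : ∀ x, 0 < noiseVar x)
    {v : ℝ} {l : List D} (hl : ∀ p ∈ l, noiseVar p = v) {x : D} (hx : noiseVar x = v) :
    infoDet k v (l ++ [x]) = infoDet k v l * (1 + postVar k noiseVar l x / v) := by
  have hv : v ≠ 0 := (hx ▸ hn x).ne'
  have hlx : ∀ p ∈ l ++ [x], noiseVar p = v := by
    simpa only [List.forall_mem_append, List.forall_mem_singleton] using ⟨hl, hx⟩
  have h := det_noisyGram_append_singleton hk hn l x
  rw [det_noisyGram_eq_infoDet hv hl, det_noisyGram_eq_infoDet hv hlx, hx, List.length_append,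
    List.length_singleton] at h
  refine mul_left_cancel₀ (pow_ne_zero (l.length + 1) hv) (h.trans ?_)
  field_simp
  ring

theorem infoDet_le_infoDet_append_singleton (hk : (Matrix.of k).PosSemidef) {v : ℝ} (hv : 0 < v)
    (l : List D) (x : D) : infoDet k v l ≤ infoDet k v (l ++ [x]) := by
  rw [infoDet_append_singleton (noiseVar := fun _ => v) hk (fun _ => hv) (fun _ _ => rfl) rfl]
  refine le_mul_of_one_le_right (infoDet_pos hk hv l).le (le_add_of_nonneg_right ?_)
  exact div_nonneg (postVar_nonneg hk (fun _ => hv) l x) hv.le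

theorem infoDet_le_prod [Fintype D] [DecidableEq D] (hk : (Matrix.of k).PosSemidef) {v : ℝ}
    (hv : 0 < v) (l : List D) : infoDet k v l ≤ ∏ z, (1 + l.count z * k z z / v) := by
  induction l using List.reverseRecOn with
  | nil => simp [infoDet_nil]
  | append_singleton l x ih =>
    have hx : 0 ≤ k x x := hk.diag_nonneg
    have hden : 0 < v + l.count x * k x x := add_pos_of_pos_of_nonneg hv (by positivity)
    have hfactor : (1 + l.count x * k x x / v) * (1 + postVar k (fun _ => v) l x / v) ≤
        1 + (l ++ [x]).count x * k x x / v := by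
      have hcount := postVar_le_of_count (noiseVar := fun _ => v) hk (fun _ => hv) l x
      calc (1 + l.count x * k x x / v) * (1 + postVar k (fun _ => v) l x / v)
          ≤ (1 + l.count x * k x x / v) *
              (1 + k x x * v / (v + l.count x * k x x) / v) := by gcongr
        _ = 1 + (l ++ [x]).count x * k x x / v := by
            rw [List.count_append, List.count_singleton_self]
            push_cast
            field_simp [hden.ne']
            ring
    have hothers : ∏ z ∈ Finset.univ.erase x, (1 + (l ++ [x]).count z * k z z / v) =
        ∏ z ∈ Finset.univ.erase x, (1 + l.count z * k z z / v) := by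
      refine Finset.prod_congr rfl fun z hz => ?_
      have hzx : ¬ (x == z) = true := by simpa using (Finset.ne_of_mem_erase hz).symm
      rw [List.count_append, List.count_singleton, if_neg hzx, add_zero]
    rw [infoDet_append_singleton (noiseVar := fun _ => v) hk (fun _ => hv) (fun _ _ => rfl) rfl]
    have hpost := postVar_nonneg (noiseVar := fun _ => v) hk (fun _ => hv) l x
    calc infoDet k v l * (1 + postVar k (fun _ => v) l x / v)
        ≤ (∏ z, (1 + l.count z * k z z / v)) * (1 + postVar k (fun _ => v) l x / v) := by gcongr
      _ = (∏ z ∈ Finset.univ.erase x, (1 + l.count z * k z z / v)) *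
            ((1 + l.count x * k x x / v) * (1 + postVar k (fun _ => v) l x / v)) := by
          rw [← Finset.prod_erase_mul _ _ (Finset.mem_univ x), mul_assoc]
      _ ≤ (∏ z ∈ Finset.univ.erase x, (1 + l.count z * k z z / v)) *
            (1 + (l ++ [x]).count x * k x x / v) := by
          refine mul_le_mul_of_nonneg_left hfactor (Finset.prod_nonneg fun z _ => ?_)
          have : 0 ≤ k z z := hk.diag_nonneg
          positivity
      _ = ∏ z, (1 + (l ++ [x]).count z * k z z / v) := by
          rw [← hothers, Finset.prod_erase_mul _ _ (Finset.mem_univ x)]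

-- `g` allows the queries to range over copies of the points of `D` at different noise levels.
theorem log_infoDet_le_maxInfoGain [Finite D] {D' : Type*} (g : D' → D) (v : ℝ) (l : List D') :
    Real.log (infoDet (fun p q => k (g p) (g q)) v l) ≤ 2 * maxInfoGain k v l.length := by
  have := le_ciSup (f := fun x : Fin l.length → D =>
    1 / 2 * Real.log (1 + v⁻¹ • Matrix.of (fun i j => k (x i) (x j))).det)
    (Set.finite_range _).bddAbove (fun i => g (l.get i))
  rw [maxInfoGain]
  simp only [infoDet]
  linarith

theorem maxInfoGain_mono [Finite D] [Nonempty D] (hk : (Matrix.of k).PosSemidef) {v : ℝ}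
    (hv : 0 < v) : Monotone (maxInfoGain k v) := by
  refine monotone_nat_of_le_succ fun n => ciSup_le fun x => ?_
  obtain ⟨p⟩ := ‹Nonempty D›
  have hgain := log_infoDet_le_maxInfoGain (k := k) id v (List.ofFn x ++ [p])
  rw [List.length_append, List.length_ofFn, List.length_singleton] at hgain
  have hle := Real.log_le_log (infoDet_pos hk hv _)
    (infoDet_le_infoDet_append_singleton hk hv (List.ofFn x) p)
  rw [infoDet_ofFn] at hle
  linarith [hle.trans hgain]

theorem half_log_le_maxInfoGain [Finite D] [Nonempty D] (hk : (Matrix.of k).PosSemidef)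
    (h1 : ∀ x, k x x = 1) {v : ℝ} (hv : 0 < v) {n : ℕ} (hn : 1 ≤ n) :
    1 / 2 * Real.log (1 + v⁻¹) ≤ maxInfoGain k v n := by
  refine le_trans ?_ (maxInfoGain_mono hk hv hn)
  obtain ⟨p⟩ := ‹Nonempty D›
  have hgain := log_infoDet_le_maxInfoGain (k := k) id v ([] ++ [p])
  simp only [id] at hgain
  rw [infoDet_append_singleton (noiseVar := fun _ => v) hk (fun _ => hv) (fun _ _ => rfl) rfl,
    infoDet_nil, postVar_nil, h1, one_mul, one_div] at hgain
  rw [List.nil_append, List.length_singleton] at hgain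
  linarith

theorem maxInfoGain_le_log [Fintype D] [Nonempty D] (hk : (Matrix.of k).PosSemidef)
    (h1 : ∀ x, k x x = 1) {v : ℝ} (hv : 0 < v) (n : ℕ) :
    maxInfoGain k v n ≤ Fintype.card D / 2 * Real.log (1 + n / v) := by
  classical
  refine ciSup_le fun x => ?_
  have hprod : infoDet k v (List.ofFn x) ≤ (1 + n / v) ^ Fintype.card D := by
    refine (infoDet_le_prod hk hv _).trans ?_
    rw [← Finset.card_univ, ← Finset.prod_const]
    refine Finset.prod_le_prod (fun z _ => by rw [h1]; positivity) fun z _ => ?_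
    have hcount : (List.ofFn x).count z ≤ n := List.count_le_length.trans_eq (by simp)
    rw [h1, mul_one]
    gcongr
  have hlog := Real.log_le_log (infoDet_pos hk hv _) hprod
  rw [Real.log_pow, infoDet_ofFn] at hlog
  linarith

end InformationGain

/-! ### Covers and submodularity -/

section Cover

variable {D₀ : Type*} {K : ℕ} {k₀ : D₀ → D₀ → ℝ} {σ2 : Fin K → ℝ}

theorem posSemidef_comp_fst {E : Type*} (hk : (Matrix.of k₀).PosSemidef) :
    (Matrix.of fun p q : D₀ × E => k₀ p.1 q.1).PosSemidef :=
  hk.submatrix Prod.fst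

theorem exists_postVar_le_or_pow_le_infoDet [Nonempty D₀] (hk : (Matrix.of k₀).PosSemidef)
    (hσ : ∀ j, 0 < σ2 j) (j : Fin K) {v : ℝ} (hv : 0 ≤ v) (n : ℕ) :
    ∃ l : List (D₀ × Fin K), l.length = n ∧ (∀ p ∈ l, p.2 = j) ∧
      ((∀ z, postVar (fun p q : D₀ × Fin K => k₀ p.1 q.1) (fun p => σ2 p.2) l z ≤ v) ∨
        (1 + v / σ2 j) ^ n ≤ infoDet (fun p q : D₀ × Fin K => k₀ p.1 q.1) (σ2 j) l) := by
  have hσj := hσ j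
  set k := fun p q : D₀ × Fin K => k₀ p.1 q.1
  have hkk : (Matrix.of k).PosSemidef := posSemidef_comp_fst hk
  induction n with
  | zero => exact ⟨[], rfl, by simp, Or.inr (by simp [infoDet_nil])⟩
  | succ n ih =>
    obtain ⟨l, hlen, hlevel, hl⟩ := ih
    have hlevel' (x₀ : D₀) : ∀ p ∈ l ++ [(x₀, j)], p.2 = j := by
      simpa only [List.forall_mem_append, List.forall_mem_singleton, and_true] using hlevel
    have hlen' (x₀ : D₀) : (l ++ [(x₀, j)]).length = n + 1 := by simp [hlen]
    by_cases hcover : ∀ z, postVar k (fun p => σ2 p.2) l z ≤ v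
    · obtain ⟨x₀⟩ := ‹Nonempty D₀›
      exact ⟨_, hlen' x₀, hlevel' x₀, Or.inl fun z =>
        (postVar_le_of_sublist hkk (fun p => hσ p.2) (List.sublist_append_left _ _) z).trans
          (hcover z)⟩
    · have hpow := hl.resolve_left hcover
      push Not at hcover
      obtain ⟨z, hz⟩ := hcover
      refine ⟨_, hlen' z.1, hlevel' z.1, Or.inr ?_⟩
      rw [infoDet_append_singleton (noiseVar := fun p => σ2 p.2) (v := σ2 j) hkk
        (fun p => hσ p.2) (fun p hp => by rw [hlevel p hp]) rfl, pow_succ]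
      change v < postVar k (fun p => σ2 p.2) l (z.1, j) at hz
      have hdet := infoDet_pos hkk hσj l
      gcongr

theorem exists_postVar_le_of_maxInfoGain_lt [Finite D₀] [Nonempty D₀]
    (hk : (Matrix.of k₀).PosSemidef) (hσ : ∀ j, 0 < σ2 j) (j : Fin K) {v : ℝ} (hv : 0 ≤ v) {n : ℕ}
    (h : 2 * maxInfoGain k₀ (σ2 j) n < n * Real.log (1 + v / σ2 j)) :
    ∃ l : List (D₀ × Fin K), l.length = n ∧ (∀ p ∈ l, p.2 = j) ∧
      ∀ z, postVar (fun p q : D₀ × Fin K => k₀ p.1 q.1) (fun p => σ2 p.2) l z ≤ v := by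
  obtain ⟨l, hlen, hlevel, hl⟩ := exists_postVar_le_or_pow_le_infoDet hk hσ j hv n
  refine ⟨l, hlen, hlevel, hl.resolve_right fun hpow => h.not_ge ?_⟩
  have hσj := hσ j
  calc n * Real.log (1 + v / σ2 j) = Real.log ((1 + v / σ2 j) ^ n) := (Real.log_pow _ _).symm
    _ ≤ _ := Real.log_le_log (by positivity) hpow
    _ ≤ 2 * maxInfoGain k₀ (σ2 j) l.length := log_infoDet_le_maxInfoGain Prod.fst (σ2 j) l
    _ = 2 * maxInfoGain k₀ (σ2 j) n := by rw [hlen]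

theorem exists_postVar_le_of_maxInfoGain_mul_le [Finite D₀] [Nonempty D₀]
    (hk : (Matrix.of k₀).PosSemidef) (hσ : ∀ j, 0 < σ2 j) (j : Fin K) {v : ℝ} (hv : 0 < v) {n : ℕ}
    (hn : 1 ≤ n) (h : 2 * maxInfoGain k₀ (σ2 j) n * (σ2 j / v + 1 / 2) ≤ n) :
    ∃ l : List (D₀ × Fin K), l.length = n ∧ (∀ p ∈ l, p.2 = j) ∧
      ∀ z, postVar (fun p q : D₀ × Fin K => k₀ p.1 q.1) (fun p => σ2 p.2) l z ≤ v := by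
  have hσj := hσ j
  refine exists_postVar_le_of_maxInfoGain_lt hk hσ j hv.le ?_
  have hn0 : (0 : ℝ) < n := by exact_mod_cast hn
  have hrate : σ2 j / v + 1 / 2 = (2 * (v / σ2 j) / (v / σ2 j + 2))⁻¹ := by field_simp; ring
  rw [hrate, ← div_eq_mul_inv, div_le_iff₀ (by positivity)] at h
  exact h.trans_lt (mul_lt_mul_of_pos_left (Real.lt_log_one_add_of_pos (by positivity)) hn0)

theorem exists_postVar_le_of_div_le [Fintype D₀] (hk : (Matrix.of k₀).PosSemidef)
    (hσ : ∀ j, 0 < σ2 j) (j : Fin K) {v : ℝ} (hv : 0 < v) {n : ℕ} (hn : σ2 j / v ≤ n) :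
    ∃ l : List (D₀ × Fin K), l.length = n * Fintype.card D₀ ∧ (∀ p ∈ l, p.2 = j) ∧
      ∀ z, postVar (fun p q : D₀ × Fin K => k₀ p.1 q.1) (fun p => σ2 p.2) l z ≤ v := by
  classical
  set l := (n • (Finset.univ : Finset D₀).val.map fun x => (x, j)).toList with hl
  refine ⟨l, by simp [hl], by simp +contextual [hl, Multiset.mem_nsmul], fun z => ?_⟩
  have hσj := hσ j
  have hn0 : (0 : ℝ) < n := (div_pos hσj hv).trans_le hn
  have hcount : @List.count _ instBEqOfDecidableEq (z.1, j) l = n := by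
    rw [← Multiset.coe_count, hl, Multiset.coe_toList, Multiset.count_nsmul,
      Multiset.count_map_eq_count' _ _ (Prod.mk_left_injective j),
      Multiset.count_eq_one_of_mem Finset.univ.nodup (Finset.mem_univ z.1), mul_one]
  have hkz : 0 ≤ k₀ z.1 z.1 := hk.diag_nonneg
  have hpost := postVar_le_of_count (posSemidef_comp_fst hk) (fun p : D₀ × Fin K => hσ p.2) l
    (z.1, j)
  rw [hcount] at hpost
  change postVar (fun p q : D₀ × Fin K => k₀ p.1 q.1) (fun p => σ2 p.2) l (z.1, j) ≤ v
  refine hpost.trans ?_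
  rw [div_le_iff₀ (by positivity)]
  rw [div_le_iff₀ hv] at hn
  nlinarith [mul_pos hv hσj, mul_le_mul_of_nonneg_left hn hkz]

end Cover

section Submodular

variable {D : Type*} {k : D → D → ℝ} {noiseVar : D → ℝ}

theorem postVar_sub_le_sum (hsub : SubmodularVarReduction k noiseVar) (l : List D) (z : D)
    (S : List D) :
    postVar k noiseVar l z - postVar k noiseVar (l ++ S) z ≤
      (S.map fun p => postVar k noiseVar l z - postVar k noiseVar (l ++ [p]) z).sum := by
  induction S using List.reverseRecOn with
  | nil => simp
  | append_singleton S p ih =>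
    have h := hsub l z [] S List.nil_subperm p
    simp only [varReduction, List.nil_append, List.append_nil] at h
    rw [List.map_append, List.sum_append, List.map_singleton, List.sum_singleton]
    linarith

theorem max_postVar_sub_le_sum (hk : (Matrix.of k).PosSemidef) (hn : ∀ x, 0 < noiseVar x)
    (hsub : SubmodularVarReduction k noiseVar) {b e : ℝ} (hb : 0 ≤ b) (l : List D) (z : D)
    {S : List D} (hS : b * postVar k noiseVar S z ≤ e) :
    max (b * postVar k noiseVar l z) e - e ≤
      (S.map fun p => max (b * postVar k noiseVar l z) e -
        max (b * postVar k noiseVar (l ++ [p]) z) e).sum := by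
  have hnonneg (p : D) : 0 ≤ max (b * postVar k noiseVar l z) e -
      max (b * postVar k noiseVar (l ++ [p]) z) e := by
    have := postVar_le_of_sublist hk hn (List.sublist_append_left l [p]) z
    exact sub_nonneg.2 (by gcongr)
  rcases le_total (b * postVar k noiseVar l z) e with hle | hle
  · rw [max_eq_right hle, sub_self]
    rw [max_eq_right hle] at hnonneg
    exact List.sum_nonneg (List.forall_mem_map.2 fun p _ => hnonneg p)
  by_cases hex : ∃ p ∈ S, b * postVar k noiseVar (l ++ [p]) z ≤ e
  · obtain ⟨p, hp, hpe⟩ := hex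
    have hterm := List.single_le_sum (List.forall_mem_map.2 fun q _ => hnonneg q) _
      (List.mem_map_of_mem hp)
    rwa [max_eq_right hpe] at hterm
  · push Not at hex
    have hnot (p) (hp : p ∈ S) : max (b * postVar k noiseVar l z) e -
        max (b * postVar k noiseVar (l ++ [p]) z) e =
        b * (postVar k noiseVar l z - postVar k noiseVar (l ++ [p]) z) := by
      rw [max_eq_left hle, max_eq_left (hex p hp).le, mul_sub]
    have hlS := postVar_le_of_sublist hk hn (List.sublist_append_right l S) z
    rw [List.map_congr_left hnot, List.sum_map_mul_left, max_eq_left hle]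
    calc b * postVar k noiseVar l z - e
        ≤ b * postVar k noiseVar l z - b * postVar k noiseVar (l ++ S) z := by
          have := mul_le_mul_of_nonneg_left hlS hb
          linarith
      _ = b * (postVar k noiseVar l z - postVar k noiseVar (l ++ S) z) := (mul_sub _ _ _).symm
      _ ≤ _ := mul_le_mul_of_nonneg_left (postVar_sub_le_sum hsub l z S) hb

end Submodular

/-! ### Greedy potential -/

theorem history_succ {D : Type*} (x : ℕ → D) (t : ℕ) :
    history x (t + 1) = history x t ++ [x t] := by
  simp [history, List.range_succ]

theorem cumCost_succ {D : Type*} (cost : D → ℝ) (x : ℕ → D) (t : ℕ) :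
    cumCost cost x (t + 1) = cumCost cost x t + cost (x t) :=
  Finset.sum_range_succ _ _

namespace Input

variable {D : Type*} {A : Input D}

/-- The standing assumptions on the input of the algorithm: a normalized kernel, positive noise
variances and costs, submodular variance reduction, target confidences that decrease to zero, and
confidence widths that do not. -/
structure IsAdmissible (A : Input D) : Prop where
  posSemidef : (Matrix.of A.kernel).PosSemidef
  kernel_self : ∀ x, A.kernel x x = 1
  noiseVar_pos : ∀ x, 0 < A.noiseVar x
  cost_pos : ∀ x, 0 < A.cost x
  submodular : SubmodularVarReduction A.kernel A.noiseVar
  δbar_pos : 0 < A.δbar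
  r_pos : 0 < A.r
  r_lt_one : A.r < 1
  η₁_pos : 0 < A.η₁
  exists_le_β : ∃ b > 0, ∀ i, b ≤ A.β i

namespace IsAdmissible

theorem η_pos (hA : A.IsAdmissible) (i : ℕ) : 0 < A.η i :=
  mul_pos hA.η₁_pos (pow_pos hA.r_pos i)

theorem β_pos (hA : A.IsAdmissible) (i : ℕ) : 0 < A.β i := by
  obtain ⟨b, hb, hβ⟩ := hA.exists_le_β
  exact hb.trans_le (hβ i)

theorem postVar_pos (hA : A.IsAdmissible) (l : List D) (z : D) :
    0 < postVar A.kernel A.noiseVar l z :=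
  TruVaR.postVar_pos hA.posSemidef hA.noiseVar_pos l z (by rw [hA.kernel_self]; exact one_pos)

theorem postVar_le_one (hA : A.IsAdmissible) (l : List D) (z : D) :
    postVar A.kernel A.noiseVar l z ≤ 1 :=
  (postVar_le_prior hA.posSemidef hA.noiseVar_pos l z).trans_eq (hA.kernel_self z)

theorem sq_sqrt_mul_postStd (hA : A.IsAdmissible) (i : ℕ) (l : List D) (z : D) :
    (√(A.β i) * postStd A.kernel A.noiseVar l z) ^ 2 =
      A.β i * postVar A.kernel A.noiseVar l z := by
  rw [postStd, mul_pow, Real.sq_sqrt (hA.β_pos i).le, Real.sq_sqrt (hA.postVar_pos l z).le]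

end IsAdmissible

/-- The sum over `M` of the excesses of the scaled posterior variances over the squared target
confidence of epoch `i`. The acquisition function is its decrease per unit cost. -/
noncomputable def potential (A : Input D) (i : ℕ) (M : Finset D) (l : List D) : ℝ :=
  ∑ z ∈ M, (max (A.β i * postVar A.kernel A.noiseVar l z) (A.η i ^ 2) - A.η i ^ 2)

/-- A potential that epoch `i` exceeds as long as it is not done. -/
noncomputable def doneLevel (A : Input D) (i : ℕ) : ℝ :=
  ((1 + A.δbar) ^ 2 - 1) * A.η i ^ 2

theorem IsAdmissible.doneLevel_pos (hA : A.IsAdmissible) (i : ℕ) : 0 < A.doneLevel i := by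
  have hd := hA.δbar_pos
  exact mul_pos (by nlinarith) (pow_pos (hA.η_pos i) 2)

theorem potential_mono {i : ℕ} {M M' : Finset D} (h : M ⊆ M') (l : List D) :
    A.potential i M l ≤ A.potential i M' l :=
  Finset.sum_le_sum_of_subset_of_nonneg h fun _ _ _ => sub_nonneg.2 (le_max_right _ _)

theorem potential_nonneg (i : ℕ) (M : Finset D) (l : List D) : 0 ≤ A.potential i M l :=
  Finset.sum_nonneg fun _ _ => sub_nonneg.2 (le_max_right _ _)

theorem potential_le_card_mul (hA : A.IsAdmissible) (i : ℕ) (M : Finset D) (l : List D) :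
    A.potential i M l ≤ M.card * A.β i := by
  rw [← nsmul_eq_mul, potential]
  refine Finset.sum_le_card_nsmul _ _ _ fun z _ => sub_le_iff_le_add.2 (max_le ?_ ?_)
  · have := mul_le_of_le_one_right (hA.β_pos i).le (hA.postVar_le_one l z)
    nlinarith [sq_nonneg (A.η i)]
  · linarith [hA.β_pos i]

theorem potential_succ_le_of_epochDone (hA : A.IsAdmissible) {i : ℕ} (hβ : A.β (i + 1) = A.β i)
    {M : Finset D} {l : List D} (h : A.EpochDone i M l) :
    A.potential (i + 1) M l ≤
      M.card * (((1 + A.δbar) ^ 2 / A.r ^ 2 - 1) * A.η (i + 1) ^ 2) := by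
  have hr := hA.r_pos
  have hη : (1 + A.δbar) ^ 2 / A.r ^ 2 * A.η (i + 1) ^ 2 = ((1 + A.δbar) * A.η i) ^ 2 := by
    rw [η, η, pow_succ]
    field_simp
    ring
  rw [← nsmul_eq_mul, potential]
  refine Finset.sum_le_card_nsmul _ _ _ fun z hz => sub_le_iff_le_add.2 ?_
  rw [sub_one_mul, sub_add_cancel, hη]
  refine max_le ?_ ?_
  · rw [hβ, ← hA.sq_sqrt_mul_postStd]
    exact pow_le_pow_left₀ (mul_nonneg (Real.sqrt_nonneg _) (Real.sqrt_nonneg _)) (h z hz) 2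
  · have hηi := (hA.η_pos i).le
    have hle : A.η (i + 1) ≤ A.η i := by
      rw [η, pow_succ, ← mul_assoc]
      exact mul_le_of_le_one_right hηi hA.r_lt_one.le
    exact pow_le_pow_left₀ (hA.η_pos _).le (hle.trans (le_mul_of_one_le_left hηi
      (by linarith [hA.δbar_pos]))) 2

theorem doneLevel_lt_potential (hA : A.IsAdmissible) {i : ℕ} {M : Finset D} {l : List D}
    (h : ¬ A.EpochDone i M l) : A.doneLevel i < A.potential i M l := by
  unfold EpochDone at h
  push Not at h
  obtain ⟨z, hz, hlt⟩ := h
  have hsq : ((1 + A.δbar) * A.η i) ^ 2 < A.β i * postVar A.kernel A.noiseVar l z := by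
    rw [← hA.sq_sqrt_mul_postStd]
    exact pow_lt_pow_left₀ hlt
      (mul_nonneg (by linarith [hA.δbar_pos]) (hA.η_pos i).le) two_ne_zero
  calc A.doneLevel i = ((1 + A.δbar) * A.η i) ^ 2 - A.η i ^ 2 := by rw [doneLevel]; ring
    _ < max (A.β i * postVar A.kernel A.noiseVar l z) (A.η i ^ 2) - A.η i ^ 2 :=
        sub_lt_sub_right (lt_max_of_lt_left hsq) _
    _ ≤ A.potential i M l :=
        Finset.single_le_sum (f := fun z => max (A.β i * postVar A.kernel A.noiseVar l z)
          (A.η i ^ 2) - A.η i ^ 2) (fun _ _ => sub_nonneg.2 (le_max_right _ _)) hz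

theorem acquisition_mul_cost (hc : ∀ x, 0 < A.cost x) (i : ℕ) (M : Finset D) (l : List D)
    (x : D) :
    A.acquisition i M l x * A.cost x = A.potential i M l - A.potential i M (l ++ [x]) := by
  rw [acquisition, div_mul_cancel₀ _ (hc x).ne', potential, potential, Finset.sum_sub_distrib,
    Finset.sum_sub_distrib, sub_sub_sub_cancel_right]

/-- A collection of queries that meets the target confidence of epoch `i` everywhere. -/
def IsCover (A : Input D) (i : ℕ) (S : List D) : Prop :=
  ∀ z, A.β i * postVar A.kernel A.noiseVar S z ≤ A.η i ^ 2

section Greedy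

variable {i : ℕ} {M : Finset D} {l S : List D} {x : D}

theorem potential_le_sum_of_isCover (hA : A.IsAdmissible) (hS : A.IsCover i S) :
    A.potential i M l ≤ (S.map fun p => A.potential i M l - A.potential i M (l ++ [p])).sum := by
  have hterm (z : D) := max_postVar_sub_le_sum hA.posSemidef hA.noiseVar_pos hA.submodular
    (hA.β_pos i).le l z (hS z)
  refine (Finset.sum_le_sum fun z _ => hterm z).trans_eq ?_
  clear hS hterm
  induction S with
  | nil => simp
  | cons p S ih =>
    simp only [List.map_cons, List.sum_cons, Finset.sum_add_distrib, ih, add_left_inj]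
    rw [potential, potential, ← Finset.sum_sub_distrib]
    exact Finset.sum_congr rfl fun z _ => (sub_sub_sub_cancel_right _ _ _).symm

theorem potential_le_acquisition_mul (hA : A.IsAdmissible) (hS : A.IsCover i S)
    (hx : ∀ x', A.acquisition i M l x' ≤ A.acquisition i M l x) :
    A.potential i M l ≤ A.acquisition i M l x * (S.map A.cost).sum := by
  refine (potential_le_sum_of_isCover hA hS).trans ?_
  rw [← List.sum_map_mul_left]
  refine List.sum_le_sum fun p _ => ?_
  rw [← acquisition_mul_cost hA.cost_pos]
  exact mul_le_mul_of_nonneg_right (hx p) (hA.cost_pos p).le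

theorem potential_append_le (hA : A.IsAdmissible) (hS : A.IsCover i S)
    (hC : 0 < (S.map A.cost).sum) (hx : ∀ x', A.acquisition i M l x' ≤ A.acquisition i M l x) :
    A.potential i M (l ++ [x]) ≤
      A.potential i M l * Real.exp (-(A.cost x / (S.map A.cost).sum)) := by
  set C := (S.map A.cost).sum
  have hgain : A.potential i M l * (A.cost x / C) ≤
      A.potential i M l - A.potential i M (l ++ [x]) := by
    have hcx := hA.cost_pos x
    calc A.potential i M l * (A.cost x / C)
        ≤ A.acquisition i M l x * C * (A.cost x / C) := by
          gcongr
          exact potential_le_acquisition_mul hA hS hx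
      _ = A.acquisition i M l x * A.cost x := by field_simp
      _ = _ := acquisition_mul_cost hA.cost_pos i M l x
  calc A.potential i M (l ++ [x]) ≤ A.potential i M l * (1 - A.cost x / C) := by linarith
    _ ≤ _ := mul_le_mul_of_nonneg_left (Real.one_sub_le_exp_neg _) (potential_nonneg i M l)

theorem cost_le_of_potential_pos (hA : A.IsAdmissible) (hS : A.IsCover i S)
    (hx : ∀ x', A.acquisition i M l x' ≤ A.acquisition i M l x) (hpos : 0 < A.potential i M l) :
    A.cost x ≤ (S.map A.cost).sum := by
  have hle := potential_le_acquisition_mul hA hS hx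
  have hC : 0 ≤ (S.map A.cost).sum :=
    List.sum_nonneg (List.forall_mem_map.2 fun p _ => (hA.cost_pos p).le)
  have hacq : 0 < A.acquisition i M l x := pos_of_mul_pos_left (hpos.trans_le hle) hC
  refine le_of_mul_le_mul_left ?_ hacq
  linarith [acquisition_mul_cost hA.cost_pos i M l x, potential_nonneg (A := A) i M (l ++ [x])]

end Greedy

section Run

theorem state_succ_M_subset [Fintype D] (x : ℕ → D) (y : ℕ → ℝ) (t : ℕ) :
    (A.state x y (t + 1)).M ⊆ (A.state x y t).M := by
  simp only [state, update]
  cases A.task <;> exact Finset.filter_subset _ _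

theorem state_succ_epoch [Fintype D] (x : ℕ → D) (y : ℕ → ℝ) (t : ℕ) :
    (A.state x y (t + 1)).epoch =
      A.nextEpoch (A.state x y t).epoch (A.state x y (t + 1)).M (history x (t + 1)) := by
  simp only [state, update]
  cases A.task <;> rfl

theorem le_nextEpoch (i : ℕ) (M : Finset D) (l : List D) : i ≤ A.nextEpoch i M l := by
  classical
  unfold nextEpoch
  split_ifs with h
  exacts [(Nat.find_spec h).1, le_rfl]

theorem epochDone_of_lt_nextEpoch {i j : ℕ} {M : Finset D} {l : List D} (hij : i ≤ j)
    (hj : j < A.nextEpoch i M l) : A.EpochDone j M l := by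
  classical
  unfold nextEpoch at hj
  split_ifs at hj with h
  · by_contra hn
    exact Nat.find_min h hj ⟨hij, hn⟩
  · exact absurd hij hj.not_ge

theorem exists_not_epochDone (hA : A.IsAdmissible) (i : ℕ) {M : Finset D} (hM : M.Nonempty)
    (l : List D) : ∃ j, i ≤ j ∧ ¬ A.EpochDone j M l := by
  obtain ⟨b, hb, hβ⟩ := hA.exists_le_β
  obtain ⟨z, hz⟩ := hM
  have hv : 0 < √b * postStd A.kernel A.noiseVar l z :=
    mul_pos (Real.sqrt_pos.2 hb) (Real.sqrt_pos.2 (hA.postVar_pos l z))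
  have htarget : Filter.Tendsto (fun j => (1 + A.δbar) * A.η j) Filter.atTop (nhds 0) := by
    simpa [η] using ((tendsto_pow_atTop_nhds_zero_of_lt_one hA.r_pos.le hA.r_lt_one).const_mul
      A.η₁).const_mul (1 + A.δbar)
  obtain ⟨j, hj, hij⟩ :=
    ((htarget.eventually_lt_const hv).and (Filter.eventually_ge_atTop i)).exists
  refine ⟨j, hij, fun hdone => (hj.trans_le ?_).not_ge (hdone z hz)⟩
  exact mul_le_mul_of_nonneg_right (Real.sqrt_le_sqrt (hβ j)) (Real.sqrt_nonneg _)

theorem not_epochDone_nextEpoch (hA : A.IsAdmissible) (i : ℕ) {M : Finset D} (hM : M.Nonempty)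
    (l : List D) : ¬ A.EpochDone (A.nextEpoch i M l) M l := by
  classical
  have hex := exists_not_epochDone hA i hM l
  rw [nextEpoch, dif_pos hex]
  exact (Nat.find_spec hex).2

end Run

end Input

/-! ### Epoch budgets -/

/-- The cost that the first `i` epochs may use when epoch `j` may use `C j * F j`. -/
noncomputable def totalBudget (C F : ℕ → ℝ) (i : ℕ) : ℝ := ∑ j ∈ Finset.range i, C j * F j

theorem totalBudget_succ (C F : ℕ → ℝ) (i : ℕ) :
    totalBudget C F (i + 1) = totalBudget C F i + C i * F i :=
  Finset.sum_range_succ _ _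

namespace Input

variable {D : Type*} {A : Input D} {C F : ℕ → ℝ}

/-- Costs `C i` of covers for the epochs, and factors `F i` such that `C i * F i` is enough for
greedy queries to end epoch `i`: a potential decays like `exp (-u / C i)` in the cost `u`, so that
after a cost of `C i * (F i - 1)` one more query is enough. -/
structure EpochBudget (A : Input D) [Fintype D] (C F : ℕ → ℝ) : Prop where
  cost_pos : ∀ i, 0 < C i
  exists_isCover : ∀ i, ∃ S, (S.map A.cost).sum = C i ∧ A.IsCover i S
  one_le : ∀ i, 1 ≤ F i
  initial : A.potential 0 Finset.univ [] ≤ A.doneLevel 0 * Real.exp (F 0 - 1)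
  initial_succ : ∀ i M l, A.EpochDone i M l →
    A.potential (i + 1) M l ≤ A.doneLevel (i + 1) * Real.exp (F (i + 1) - 1)

/-- Invariant of a run that has spent `c` and is in epoch `i`. The second part excludes that the
epoch is over; in the first epoch this is known only after the first query. -/
def OnTrack (A : Input D) (C F : ℕ → ℝ) (c : ℝ) (i : ℕ) (M : Finset D) (l : List D) : Prop :=
  A.potential i M l ≤ A.doneLevel i * Real.exp (F i - 1 - (c - totalBudget C F i) / C i) ∧
    (c ≤ totalBudget C F i ∧ 0 < A.potential i M l ∨ A.doneLevel i < A.potential i M l)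

namespace EpochBudget

variable [Fintype D]

theorem monotone_totalBudget (hE : A.EpochBudget C F) : Monotone (totalBudget C F) :=
  monotone_nat_of_le_succ fun i => by
    rw [totalBudget_succ]
    exact le_add_of_nonneg_right
      (mul_nonneg (hE.cost_pos i).le (zero_le_one.trans (hE.one_le i)))

theorem add_cost_le (hA : A.IsAdmissible) (hE : A.EpochBudget C F) {c : ℝ} {i : ℕ} {M : Finset D}
    {l : List D} {x : D} (h : A.OnTrack C F c i M l)
    (hx : ∀ x', A.acquisition i M l x' ≤ A.acquisition i M l x) :
    c + A.cost x ≤ totalBudget C F (i + 1) := by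
  obtain ⟨hpot, hopen⟩ := h
  obtain ⟨S, hC, hS⟩ := hE.exists_isCover i
  have hCi := hE.cost_pos i
  have hF := hE.one_le i
  have hθ := hA.doneLevel_pos i
  have hpos : 0 < A.potential i M l := hopen.elim And.right hθ.trans
  have hcost : A.cost x ≤ C i := hC ▸ cost_le_of_potential_pos hA hS hx hpos
  rw [totalBudget_succ]
  rcases hopen with ⟨hc, -⟩ | hlt
  · nlinarith
  · have hexp : 0 < F i - 1 - (c - totalBudget C F i) / C i :=
      Real.one_lt_exp_iff.1 ((lt_mul_iff_one_lt_right hθ).1 (hlt.trans_le hpot))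
    rw [sub_pos, div_lt_iff₀ hCi] at hexp
    linarith

variable {x : ℕ → D} {y : ℕ → ℝ}

theorem onTrack_zero [Nonempty D] (hA : A.IsAdmissible) (hE : A.EpochBudget C F)
    (hβ : A.η₁ ^ 2 < A.β 0) : A.OnTrack C F 0 0 Finset.univ [] := by
  refine ⟨?_, Or.inl ⟨by simp [totalBudget], ?_⟩⟩
  · simpa [totalBudget] using hE.initial
  · refine Finset.sum_pos (fun z _ => sub_pos.2 (lt_max_of_lt_left ?_)) Finset.univ_nonempty
    rwa [postVar_nil, hA.kernel_self, mul_one, η, pow_zero, mul_one]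

theorem onTrack_succ (hA : A.IsAdmissible) (hE : A.EpochBudget C F)
    (hg : A.GreedySelection x y) {t : ℕ} (hM : (A.state x y (t + 1)).M.Nonempty)
    (h : A.OnTrack C F (cumCost A.cost x t) (A.state x y t).epoch (A.state x y t).M
      (history x t)) :
    A.OnTrack C F (cumCost A.cost x (t + 1)) (A.state x y (t + 1)).epoch
      (A.state x y (t + 1)).M (history x (t + 1)) := by
  set i := (A.state x y t).epoch
  set M' := (A.state x y (t + 1)).M
  set l' := history x (t + 1)
  have hepoch : (A.state x y (t + 1)).epoch = A.nextEpoch i M' l' := state_succ_epoch x y t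
  rw [hepoch]
  refine ⟨?_, Or.inr (doneLevel_lt_potential hA (not_epochDone_nextEpoch hA i hM l'))⟩
  rcases (le_nextEpoch i M' l').eq_or_lt with heq | hlt
  · rw [← heq]
    obtain ⟨S, hC, hS⟩ := hE.exists_isCover i
    calc A.potential i M' l'
        ≤ A.potential i (A.state x y t).M (history x t ++ [x t]) := by
          rw [← history_succ]
          exact potential_mono (state_succ_M_subset x y t) _
      _ ≤ _ := potential_append_le hA hS (hC ▸ hE.cost_pos i) (hg t)
      _ ≤ _ := mul_le_mul_of_nonneg_right h.1 (Real.exp_pos _).le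
      _ = _ := by
          rw [mul_assoc, ← Real.exp_add, cumCost_succ, hC]
          ring_nf
  · obtain ⟨j, hj⟩ := Nat.exists_eq_add_one_of_ne_zero (Nat.ne_zero_of_lt hlt)
    rw [hj] at hlt ⊢
    have hdone : A.EpochDone j M' l' :=
      epochDone_of_lt_nextEpoch (Nat.lt_succ_iff.1 hlt) (hj ▸ j.lt_succ_self)
    refine (hE.initial_succ j M' l' hdone).trans ?_
    have hspent : cumCost A.cost x (t + 1) ≤ totalBudget C F (j + 1) := by
      rw [cumCost_succ]
      exact (hE.add_cost_le hA h (hg t)).trans (hE.monotone_totalBudget hlt)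
    have := div_nonpos_of_nonpos_of_nonneg (sub_nonpos.2 hspent) (hE.cost_pos (j + 1)).le
    exact mul_le_mul_of_nonneg_left (Real.exp_le_exp.2 (by linarith)) (hA.doneLevel_pos _).le

theorem onTrack [Nonempty D] (hA : A.IsAdmissible) (hE : A.EpochBudget C F)
    (hβ : A.η₁ ^ 2 < A.β 0) (hg : A.GreedySelection x y) {t : ℕ}
    (hM : (A.state x y t).M.Nonempty) :
    A.OnTrack C F (cumCost A.cost x t) (A.state x y t).epoch (A.state x y t).M (history x t) := by
  induction t with
  | zero => exact hE.onTrack_zero hA hβ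
  | succ t ih => exact hE.onTrack_succ hA hg hM (ih (hM.mono (state_succ_M_subset x y t)))

theorem cumCost_succ_le [Nonempty D] (hA : A.IsAdmissible) (hE : A.EpochBudget C F)
    (hβ : A.η₁ ^ 2 < A.β 0) (hg : A.GreedySelection x y) {t : ℕ}
    (hM : (A.state x y t).M.Nonempty) :
    cumCost A.cost x (t + 1) ≤ totalBudget C F ((A.state x y t).epoch + 1) := by
  rw [cumCost_succ]
  exact hE.add_cost_le hA (hE.onTrack hA hβ hg hM) (hg t)

end EpochBudget

end Input

/-! ### Accuracy of the state -/

namespace Input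

variable {D : Type*} [Fintype D] {A : Input D}

/-- The confidence bounds that the algorithm uses are valid as long as points remain. -/
def ConfidenceValid (A : Input D) (f : D → ℝ) (x : ℕ → D) (y : ℕ → ℝ) : Prop :=
  ∀ t, (A.state x y t).M.Nonempty → ∀ z,
    |f z - postMean A.kernel A.noiseVar (history x (t + 1)) y z| ≤
      √(A.β (A.state x y t).epoch) * postStd A.kernel A.noiseVar (history x (t + 1)) z

/-- The epochs up to `m` share one confidence width, and the target confidence of epoch `m` is
small enough that its end certifies the accuracy `ε`. -/
structure IsFinalEpoch (A : Input D) (ε : ℝ) (m : ℕ) : Prop where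
  β_eq : ∀ i ≤ m, A.β i = A.β m
  four_mul_le : 4 * ((1 + A.δbar) * A.η m) ≤ ε

variable {f : D → ℝ} {x : ℕ → D} {y : ℕ → ℝ} {ε θ : ℝ} {m t : ℕ} {z : D}

theorem ConfidenceValid.lcb_le (h : A.ConfidenceValid f x y) (hM : (A.state x y t).M.Nonempty)
    (z : D) : A.lcb (A.state x y t).epoch (history x (t + 1)) y z ≤ f z := by
  rw [lcb]
  linarith [(abs_le.1 (h t hM z)).1]

theorem ConfidenceValid.le_ucb (h : A.ConfidenceValid f x y) (hM : (A.state x y t).M.Nonempty)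
    (z : D) : f z ≤ A.ucb (A.state x y t).epoch (history x (t + 1)) y z := by
  rw [ucb]
  linarith [(abs_le.1 (h t hM z)).2]

theorem IsFinalEpoch.ucb_sub_lcb_le (hm : A.IsFinalEpoch ε m)
    (hle : (A.state x y t).epoch ≤ m) (hlt : m < (A.state x y (t + 1)).epoch)
    (hz : z ∈ (A.state x y (t + 1)).M) :
    A.ucb (A.state x y t).epoch (history x (t + 1)) y z -
      A.lcb (A.state x y t).epoch (history x (t + 1)) y z ≤ ε / 2 := by
  rw [state_succ_epoch] at hlt
  have hdone := epochDone_of_lt_nextEpoch hle hlt z hz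
  rw [← hm.β_eq _ hle] at hdone
  rw [ucb, lcb]
  linarith [hm.four_mul_le]

section BO

theorem mem_state_succ_M_bo (hA : A.task = Task.bo) :
    z ∈ (A.state x y (t + 1)).M ↔ z ∈ (A.state x y t).M ∧ ∀ z' ∈ (A.state x y t).M,
      A.lcb (A.state x y t).epoch (history x (t + 1)) y z' ≤
        A.ucb (A.state x y t).epoch (history x (t + 1)) y z := by
  simp only [state, update, hA, Finset.mem_filter]

theorem mem_state_M_of_isMax (hA : A.task = Task.bo) (h : A.ConfidenceValid f x y)
    (hz : ∀ w, f w ≤ f z) (t : ℕ) : z ∈ (A.state x y t).M := by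
  induction t with
  | zero => exact Finset.mem_univ z
  | succ t ih =>
    exact (mem_state_succ_M_bo hA).2
      ⟨ih, fun z' _ => ((h.lcb_le ⟨z, ih⟩ z').trans (hz z')).trans (h.le_ucb ⟨z, ih⟩ z)⟩

theorem sub_le_of_mem_state_M (hA : A.task = Task.bo) (h : A.ConfidenceValid f x y)
    (hm : A.IsFinalEpoch ε m) (hlt : m < (A.state x y t).epoch) (hz : z ∈ (A.state x y t).M)
    {z' : D} (hz' : ∀ w, f w ≤ f z') : f z' - f z ≤ ε := by
  induction t with
  | zero => exact absurd hlt m.not_lt_zero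
  | succ t ih =>
    have hzM := state_succ_M_subset x y t hz
    rcases lt_or_ge m (A.state x y t).epoch with hlt' | hle
    · exact ih hlt' hzM
    have hz'M := mem_state_M_of_isMax hA h hz'
    have hkept := ((mem_state_succ_M_bo hA).1 hz).2 z' (hz'M t)
    linarith [hm.ucb_sub_lcb_le hle hlt hz, hm.ucb_sub_lcb_le hle hlt (hz'M (t + 1)),
      h.lcb_le ⟨z, hzM⟩ z, h.le_ucb ⟨z, hzM⟩ z']

end BO

section LSE

theorem mem_state_succ_M_lse (hA : A.task = Task.lse θ) :
    z ∈ (A.state x y (t + 1)).M ↔ z ∈ (A.state x y t).M ∧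
      θ ≤ A.ucb (A.state x y t).epoch (history x (t + 1)) y z ∧
      A.lcb (A.state x y t).epoch (history x (t + 1)) y z ≤ θ := by
  simp only [state, update, hA, Finset.mem_filter]

theorem mem_state_succ_H (hA : A.task = Task.lse θ) :
    z ∈ (A.state x y (t + 1)).H ↔ z ∈ (A.state x y t).H ∨
      z ∈ (A.state x y t).M ∧ θ < A.lcb (A.state x y t).epoch (history x (t + 1)) y z := by
  simp only [state, update, hA, Finset.mem_filter, Finset.mem_union]

theorem mem_state_succ_L (hA : A.task = Task.lse θ) :
    z ∈ (A.state x y (t + 1)).L ↔ z ∈ (A.state x y t).L ∨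
      z ∈ (A.state x y t).M ∧ A.ucb (A.state x y t).epoch (history x (t + 1)) y z < θ := by
  simp only [state, update, hA, Finset.mem_filter, Finset.mem_union]

theorem lt_of_mem_state_H (hA : A.task = Task.lse θ) (h : A.ConfidenceValid f x y)
    (hz : z ∈ (A.state x y t).H) : θ < f z := by
  induction t with
  | zero => exact absurd hz (Finset.notMem_empty z)
  | succ t ih =>
    rcases (mem_state_succ_H hA).1 hz with hz | ⟨hzM, hz⟩
    exacts [ih hz, hz.trans_le (h.lcb_le ⟨z, hzM⟩ z)]

theorem lt_of_mem_state_L (hA : A.task = Task.lse θ) (h : A.ConfidenceValid f x y)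
    (hz : z ∈ (A.state x y t).L) : f z < θ := by
  induction t with
  | zero => exact absurd hz (Finset.notMem_empty z)
  | succ t ih =>
    rcases (mem_state_succ_L hA).1 hz with hz | ⟨hzM, hz⟩
    exacts [ih hz, (h.le_ucb ⟨z, hzM⟩ z).trans_lt hz]

theorem abs_sub_le_of_mem_state_M (hA : A.task = Task.lse θ) (h : A.ConfidenceValid f x y)
    (hm : A.IsFinalEpoch ε m) (hlt : m < (A.state x y t).epoch) (hz : z ∈ (A.state x y t).M) :
    |f z - θ| ≤ ε / 2 := by
  induction t with
  | zero => exact absurd hlt m.not_lt_zero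
  | succ t ih =>
    obtain ⟨hzM, hu, hl⟩ := (mem_state_succ_M_lse hA).1 hz
    rcases lt_or_ge m (A.state x y t).epoch with hlt' | hle
    · exact ih hlt' hzM
    have hwidth := hm.ucb_sub_lcb_le hle hlt hz
    rw [abs_le]
    constructor <;> linarith [h.lcb_le ⟨z, hzM⟩ z, h.le_ucb ⟨z, hzM⟩ z]

end LSE

theorem ConfidenceValid.epsAccurate [Nonempty D] (h : A.ConfidenceValid f x y)
    (hm : A.IsFinalEpoch ε m) (ht : (A.state x y t).M.Nonempty → m < (A.state x y t).epoch) :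
    EpsAccurate f ε (A.state x y t) A.task := by
  rcases hA : A.task with _ | θ
  · obtain ⟨z, hz⟩ := Finite.exists_max f
    have hlt := ht ⟨z, mem_state_M_of_isMax hA h hz t⟩
    exact ⟨fun z hz => mem_state_M_of_isMax hA h hz t,
      fun z hz z' hz' => sub_le_of_mem_state_M hA h hm hlt hz hz'⟩
  · exact ⟨fun z hz => lt_of_mem_state_H hA h hz, fun z hz => lt_of_mem_state_L hA h hz,
      fun z hz => abs_sub_le_of_mem_state_M hA h hm (ht ⟨z, hz⟩) hz⟩

end Input

/-! ### Gaussian observations -/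

section GaussianTail

theorem gaussianPDFReal_neg_mean_le {v : ℝ≥0} {c u : ℝ} (hc : 0 ≤ c) (hu : 0 ≤ u) :
    gaussianPDFReal (-c) v u ≤ Real.exp (-(c ^ 2 / (2 * v))) * gaussianPDFReal 0 v u := by
  rw [gaussianPDFReal, gaussianPDFReal, mul_left_comm, ← Real.exp_add, neg_div, neg_div, ← neg_add,
    ← add_div]
  gcongr
  nlinarith [mul_nonneg hc hu]

theorem gaussianReal_Ioi_le {v : ℝ≥0} (hv : v ≠ 0) {c : ℝ} (hc : 0 ≤ c) :
    gaussianReal 0 v (Set.Ioi c) ≤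
      ENNReal.ofReal (Real.exp (-(c ^ 2 / (2 * v)))) * gaussianReal 0 v (Set.Ioi 0) := by
  have hshift : gaussianReal 0 v (Set.Ioi c) = gaussianReal (-c) v (Set.Ioi 0) := by
    rw [← zero_sub, ← gaussianReal_map_sub_const c,
      Measure.map_apply (by fun_prop) measurableSet_Ioi, Set.preimage_sub_const_Ioi, zero_add]
  rw [hshift, gaussianReal_apply _ hv, gaussianReal_apply _ hv,
    ← lintegral_const_mul _ (measurable_gaussianPDF _ _)]
  refine setLIntegral_mono' measurableSet_Ioi fun u hu => ?_
  rw [gaussianPDF, gaussianPDF, ← ENNReal.ofReal_mul (Real.exp_pos _).le]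
  exact ENNReal.ofReal_le_ofReal (gaussianPDFReal_neg_mean_le hc (le_of_lt hu))

theorem gaussianReal_Iio_neg (v : ℝ≥0) (c : ℝ) :
    gaussianReal 0 v (Set.Iio (-c)) = gaussianReal 0 v (Set.Ioi c) := by
  have hneg : (gaussianReal 0 v).map (fun u => -u) = gaussianReal 0 v := by
    rw [gaussianReal_map_neg, neg_zero]
  conv_rhs => rw [← hneg, Measure.map_apply (by fun_prop) measurableSet_Ioi]
  congr 1
  ext u
  exact lt_neg (a := u) (b := c)

theorem gaussianReal_lt_abs_le {v : ℝ≥0} (hv : v ≠ 0) {c : ℝ} (hc : 0 ≤ c) :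
    gaussianReal 0 v {u | c < |u|} ≤ ENNReal.ofReal (Real.exp (-(c ^ 2 / (2 * v)))) := by
  set e := ENNReal.ofReal (Real.exp (-(c ^ 2 / (2 * v))))
  have hset : {u : ℝ | c < |u|} = Set.Iio (-c) ∪ Set.Ioi c := by
    ext u
    exact lt_abs.trans (or_comm.trans (or_congr (lt_neg (a := c) (b := u)) Iff.rfl))
  have hzero : gaussianReal 0 v (Set.Iio 0) = gaussianReal 0 v (Set.Ioi 0) := by
    simpa using gaussianReal_Iio_neg v 0
  calc gaussianReal 0 v {u | c < |u|}
      ≤ gaussianReal 0 v (Set.Iio (-c)) + gaussianReal 0 v (Set.Ioi c) := by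
        rw [hset]
        exact measure_union_le _ _
    _ ≤ e * gaussianReal 0 v (Set.Iio 0) + e * gaussianReal 0 v (Set.Ioi 0) := by
        rw [gaussianReal_Iio_neg, hzero]
        gcongr <;> exact gaussianReal_Ioi_le hv hc
    _ = e * gaussianReal 0 v (Set.Iio 0 ∪ Set.Ioi 0) := by
        rw [← mul_add, measure_union Set.Iio_disjoint_Ioi_same measurableSet_Ioi]
    _ ≤ e := mul_le_of_le_one_right' prob_le_one

end GaussianTail

theorem covariance_dotProduct_right {Ω ι : Type*} [Fintype ι] [MeasurableSpace Ω] {P : Measure Ω}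
    [IsFiniteMeasure P] {X : Ω → ℝ} {Y : ι → Ω → ℝ} (hX : MemLp X 2 P) (hY : ∀ i, MemLp (Y i) 2 P)
    (a : ι → ℝ) : cov[X, fun ω => a ⬝ᵥ fun i => Y i ω; P] = a ⬝ᵥ fun i => cov[X, Y i; P] := by
  simp only [dotProduct]
  rw [covariance_fun_sum_right (fun i => (hY i).const_mul _) hX]
  simp only [covariance_const_mul_right]

section Observations

variable {D : Type*} {Ω : Type*} [MeasurableSpace Ω] {P : Measure Ω}
  {k : D → D → ℝ} {noiseVar : D → ℝ} {f : D → Ω → ℝ} {w : ℕ → Ω → ℝ}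

/-- The observations that the queries of a fixed list would give. An adaptive run is compared with
these on the event that its queries form that list. -/
noncomputable def observation (noiseVar : D → ℝ) (f : D → Ω → ℝ) (w : ℕ → Ω → ℝ) (l : List D)
    (i : Fin l.length) (ω : Ω) : ℝ :=
  f (l.get i) ω + √(noiseVar (l.get i)) * w i ω

/-- The error of the posterior mean at `z` after the queries of a fixed list. -/
noncomputable def predError (k : D → D → ℝ) (noiseVar : D → ℝ) (f : D → Ω → ℝ) (w : ℕ → Ω → ℝ)
    (l : List D) (z : D) (ω : Ω) : ℝ :=
  f z ω - predWeights k noiseVar l z ⬝ᵥ fun i => observation noiseVar f w l i ω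

theorem postMean_eq_dotProduct (hk : (Matrix.of k).PosSemidef) (l : List D) (y : ℕ → ℝ) (z : D) :
    postMean k noiseVar l y z = predWeights k noiseVar l z ⬝ᵥ fun i => y i := by
  rw [postMean, Matrix.dotProduct_mulVec, ← Matrix.mulVec_transpose, Matrix.transpose_nonsing_inv,
    noisyGram_transpose hk, predWeights]

theorem measurable_observation (hf : ∀ x, Measurable (f x)) (hw : ∀ t, Measurable (w t))
    (l : List D) (i : Fin l.length) : Measurable (observation noiseVar f w l i) :=
  (hf _).add ((hw _).const_mul _)

theorem measurable_predError (hf : ∀ x, Measurable (f x)) (hw : ∀ t, Measurable (w t))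
    (l : List D) (z : D) : Measurable (predError k noiseVar f w l z) :=
  (hf z).sub (Finset.measurable_sum _ fun i _ => (measurable_observation hf hw l i).const_mul _)

theorem IsStdNoise.hasGaussianLaw (hw : IsStdNoise w f P) (t : ℕ) : HasGaussianLaw (w t) P where
  isGaussian_map := by
    rw [hw.gaussian]
    infer_instance

theorem IsStdNoise.integral_eq_zero (hw : IsStdNoise w f P) (t : ℕ) : ∫ ω, w t ω ∂P = 0 := by
  have h : HasLaw (w t) (gaussianReal 0 1) P := ⟨(hw.measurable t).aemeasurable, hw.gaussian t⟩
  rw [h.integral_eq, integral_id_gaussianReal]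

theorem IsStdNoise.covariance_eq (hw : IsStdNoise w f P) (s t : ℕ) :
    cov[w s, w t; P] = if s = t then 1 else 0 := by
  split_ifs with hst
  · subst hst
    have h : HasLaw (w s) (gaussianReal 0 1) P := ⟨(hw.measurable s).aemeasurable, hw.gaussian s⟩
    rw [covariance_self h.aemeasurable, h.variance_eq, variance_id_gaussianReal, NNReal.coe_one]
  · exact (hw.indep.indepFun hst).covariance_eq_zero (hw.hasGaussianLaw s).memLp_two
      (hw.hasGaussianLaw t).memLp_two

theorem IsCenteredGP.memLp_two (hf : IsCenteredGP k f P) (z : D) : MemLp (f z) 2 P :=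
  (hf.gaussian.hasGaussianLaw_eval z).memLp_two

variable (hf : IsCenteredGP k f P) (hw : IsStdNoise w f P)
include hf hw

theorem memLp_observation (l : List D) (i : Fin l.length) :
    MemLp (observation noiseVar f w l i) 2 P :=
  (hf.memLp_two _).add ((hw.hasGaussianLaw _).memLp_two.const_mul _)

theorem memLp_dotProduct_observation (l : List D) (a : Fin l.length → ℝ) :
    MemLp (fun ω => a ⬝ᵥ fun i => observation noiseVar f w l i ω) 2 P :=
  memLp_finsetSum _ fun i _ => (memLp_observation hf hw l i).const_mul _

theorem covariance_reward_noise (z : D) (t : ℕ) : cov[f z, w t; P] = 0 := by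
  have hindep : IndepFun (w t) (f z) P := hw.indep_f.comp (φ := fun v : ℕ → ℝ => v t)
    (ψ := fun v : D → ℝ => v z) (measurable_pi_apply t) (measurable_pi_apply z)
  exact hindep.symm.covariance_eq_zero (hf.memLp_two z) (hw.hasGaussianLaw t).memLp_two

theorem hasGaussianLaw_reward_noise [Finite D] (n : ℕ) :
    HasGaussianLaw (fun ω => ((fun x => f x ω), fun i : Fin n => w i ω)) P := by
  have := Fintype.ofFinite D
  have hreward : HasGaussianLaw (fun ω x => f x ω) P :=
    (hf.gaussian.hasGaussianLaw Finset.univ).map (ContinuousLinearMap.pi fun x =>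
      ContinuousLinearMap.proj (R := ℝ) (φ := fun _ : (Finset.univ : Finset D) => ℝ)
        ⟨x, Finset.mem_univ x⟩)
  have hnoise : HasGaussianLaw (fun ω (i : Fin n) => w i ω) P :=
    iIndepFun.hasGaussianLaw (fun i => hw.hasGaussianLaw i)
      (hw.indep.precomp (g := fun i : Fin n => (i : ℕ)) Fin.val_injective)
  refine IndepFun.hasGaussianLaw hreward hnoise ?_
  exact (hw.indep_f.comp (φ := fun v : ℕ → ℝ => fun i : Fin n => v i) (ψ := id)
    (by fun_prop) measurable_id).symm

theorem hasGaussianLaw_predError_observation [Finite D] (l : List D) (z : D) :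
    HasGaussianLaw (fun ω => (fun _ : Unit => predError k noiseVar f w l z ω,
      fun i => observation noiseVar f w l i ω)) P := by
  have := Fintype.ofFinite D
  let O : ((D → ℝ) × (Fin l.length → ℝ)) →L[ℝ] Fin l.length → ℝ := .pi fun i =>
    (ContinuousLinearMap.proj (l.get i)).comp (.fst ..) +
      √(noiseVar (l.get i)) • (ContinuousLinearMap.proj i).comp (.snd ..)
  let Z : ((D → ℝ) × (Fin l.length → ℝ)) →L[ℝ] Unit → ℝ := .pi fun _ =>
    (ContinuousLinearMap.proj z).comp (.fst ..) -
      ∑ i, predWeights k noiseVar l z i • (ContinuousLinearMap.proj i).comp O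
  have hmap : (fun ω => (fun _ : Unit => predError k noiseVar f w l z ω,
      fun i => observation noiseVar f w l i ω)) =
      Z.prod O ∘ fun ω => ((fun x => f x ω), fun i : Fin l.length => w i ω) := by
    funext ω
    simp [Z, O, predError, observation, dotProduct, mul_add]
  rw [hmap]
  exact (hasGaussianLaw_reward_noise hf hw l.length).map (Z.prod O)

variable [IsProbabilityMeasure P]

theorem covariance_reward_observation (l : List D) (z : D) (i : Fin l.length) :
    cov[f z, observation noiseVar f w l i; P] = k z (l.get i) := by
  change cov[f z, f (l.get i) + fun ω => √(noiseVar (l.get i)) * w i ω; P] = _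
  rw [covariance_add_right (hf.memLp_two z) (hf.memLp_two _)
    ((hw.hasGaussianLaw i).memLp_two.const_mul _), covariance_const_mul_right,
    covariance_reward_noise hf hw, hf.covariance, mul_zero, add_zero]

theorem covariance_observation (hn : ∀ x, 0 < noiseVar x) (l : List D) (i j : Fin l.length) :
    cov[observation noiseVar f w l i, observation noiseVar f w l j; P] =
      noisyGram k noiseVar l i j := by
  have hnoise (i : Fin l.length) : MemLp (fun ω => √(noiseVar (l.get i)) * w i ω) 2 P :=
    (hw.hasGaussianLaw i).memLp_two.const_mul _
  have hsplit (i : Fin l.length) : observation noiseVar f w l i =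
      f (l.get i) + fun ω => √(noiseVar (l.get i)) * w i ω := rfl
  rw [hsplit i, covariance_add_left (hf.memLp_two _) (hnoise i) (memLp_observation hf hw l j),
    covariance_reward_observation hf hw, hsplit j,
    covariance_add_right (hnoise i) (hf.memLp_two _) (hnoise j), covariance_const_mul_left,
    covariance_const_mul_left, covariance_const_mul_right, covariance_comm (w i),
    covariance_reward_noise hf hw, hw.covariance_eq, noisyGram, Matrix.add_apply, Matrix.of_apply,
    Matrix.diagonal_apply]
  by_cases hij : i = j
  · rw [hij, if_pos rfl, if_pos rfl, mul_one, Real.mul_self_sqrt (hn _).le, mul_zero, zero_add]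
  · rw [if_neg (Fin.val_ne_of_ne hij), if_neg hij, mul_zero, mul_zero, mul_zero, add_zero]

theorem variance_reward_sub_dotProduct_observation (hk : (Matrix.of k).PosSemidef)
    (hn : ∀ x, 0 < noiseVar x) (l : List D) (z : D) (a : Fin l.length → ℝ) :
    Var[f z - fun ω => a ⬝ᵥ fun i => observation noiseVar f w l i ω; P] =
      predRisk k noiseVar l z a := by
  have hobs := memLp_observation (noiseVar := noiseVar) hf hw l
  have hsum := memLp_dotProduct_observation (noiseVar := noiseVar) hf hw l a
  set Y := fun ω => a ⬝ᵥ fun i => observation noiseVar f w l i ω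
  have hcross : cov[f z, Y; P] = a ⬝ᵥ kernelVec k l z := by
    rw [covariance_dotProduct_right (hf.memLp_two z) hobs]
    simp only [covariance_reward_observation hf hw, kernel_symm hk z]
    rfl
  have hself : cov[Y, Y; P] = a ⬝ᵥ noisyGram k noiseVar l *ᵥ a := by
    rw [covariance_dotProduct_right hsum hobs]
    congr 1
    ext i
    rw [covariance_comm, covariance_dotProduct_right (hobs i) hobs, Matrix.mulVec,
      dotProduct_comm]
    simp only [covariance_observation hf hw hn]
  rw [← covariance_self ((hf.memLp_two z).sub hsum).aemeasurable,
    covariance_sub_sub (hf.memLp_two z) hsum (hf.memLp_two z) hsum, hself,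
    covariance_comm Y, hcross, hf.covariance, predRisk]
  ring

theorem variance_predError (hk : (Matrix.of k).PosSemidef) (hn : ∀ x, 0 < noiseVar x)
    (l : List D) (z : D) : Var[predError k noiseVar f w l z; P] = postVar k noiseVar l z :=
  (variance_reward_sub_dotProduct_observation hf hw hk hn l z _).trans
    (predRisk_predWeights hk hn l z)

theorem covariance_predError_observation (hk : (Matrix.of k).PosSemidef)
    (hn : ∀ x, 0 < noiseVar x) (l : List D) (z : D) (j : Fin l.length) :
    cov[predError k noiseVar f w l z, observation noiseVar f w l j; P] = 0 := by
  have hobs := memLp_observation (noiseVar := noiseVar) hf hw l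
  have hnormal := congrFun (noisyGram_mulVec_predWeights hk hn l z) j
  rw [Matrix.mulVec, dotProduct_comm] at hnormal
  change cov[f z - fun ω => predWeights k noiseVar l z ⬝ᵥ
    fun i => observation noiseVar f w l i ω, _; P] = 0
  rw [covariance_sub_left (hf.memLp_two z) (memLp_dotProduct_observation hf hw l _) (hobs j),
    covariance_comm (fun ω => _ ⬝ᵥ _), covariance_dotProduct_right (hobs j) hobs,
    covariance_reward_observation hf hw]
  simp only [covariance_observation hf hw hn]
  rw [hnormal, kernel_symm hk, kernelVec, sub_self]

theorem integral_predError (l : List D) (z : D) :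
    ∫ ω, predError k noiseVar f w l z ω ∂P = 0 := by
  have hobs (i : Fin l.length) : ∫ ω, observation noiseVar f w l i ω ∂P = 0 := by
    unfold observation
    rw [integral_add ((hf.memLp_two _).integrable one_le_two)
      (((hw.hasGaussianLaw i).integrable).const_mul _), hf.mean_zero, integral_const_mul,
      hw.integral_eq_zero, mul_zero, add_zero]
  unfold predError
  rw [integral_sub ((hf.memLp_two z).integrable one_le_two)
    ((memLp_dotProduct_observation hf hw l _).integrable one_le_two), hf.mean_zero]
  unfold dotProduct
  rw [integral_finsetSum _ fun i _ =>
    ((memLp_observation hf hw l i).integrable one_le_two).const_mul _]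
  simp [integral_const_mul, hobs]

theorem map_predError [Finite D] (hk : (Matrix.of k).PosSemidef) (hn : ∀ x, 0 < noiseVar x)
    (l : List D) (z : D) :
    P.map (predError k noiseVar f w l z) = gaussianReal 0 (postVar k noiseVar l z).toNNReal := by
  have hgauss : HasGaussianLaw (predError k noiseVar f w l z) P :=
    (hasGaussianLaw_predError_observation (noiseVar := noiseVar) hf hw l z).fst.eval ()
  rw [hgauss.map_eq_gaussianReal, integral_predError hf hw, variance_predError hf hw hk hn]

theorem indepFun_predError_observation [Finite D] (hk : (Matrix.of k).PosSemidef)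
    (hn : ∀ x, 0 < noiseVar x) (l : List D) (z : D) :
    IndepFun (predError k noiseVar f w l z) (fun ω i => observation noiseVar f w l i ω) P := by
  have hindep := HasGaussianLaw.indepFun_of_covariance_eval
    (X := fun _ : Unit => predError k noiseVar f w l z) (Y := observation noiseVar f w l)
    (hasGaussianLaw_predError_observation (noiseVar := noiseVar) hf hw l z)
    (fun _ j => covariance_predError_observation hf hw hk hn l z j)
  exact hindep.comp (φ := fun v : Unit → ℝ => v ()) (ψ := id) (measurable_pi_apply ())
    measurable_id

theorem measure_lt_abs_predError_le [Finite D] (hk : (Matrix.of k).PosSemidef)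
    (hn : ∀ x, 0 < noiseVar x) (l : List D) (z : D) (hv : 0 < postVar k noiseVar l z) {s : ℝ}
    (hs : 0 ≤ s) :
    P (predError k noiseVar f w l z ⁻¹' {u | s * postStd k noiseVar l z < |u|}) ≤
      ENNReal.ofReal (Real.exp (-(s ^ 2 / 2))) := by
  rw [← Measure.map_apply (measurable_predError hf.measurable hw.measurable l z)
    (measurableSet_lt measurable_const (by fun_prop)), map_predError hf hw hk hn]
  refine (gaussianReal_lt_abs_le (Real.toNNReal_pos.2 hv).ne'
    (mul_nonneg hs (Real.sqrt_nonneg _))).trans_eq ?_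
  rw [mul_pow, Real.sq_sqrt hv.le, Real.coe_toNNReal _ hv.le, mul_div_mul_right _ _ hv.ne']

end Observations

/-! ### Confidence bounds -/

theorem measure_le_of_forall_inter_fiber_le {Ω ι : Type*} [MeasurableSpace Ω] {P : Measure Ω}
    [IsProbabilityMeasure P] [Countable ι] {X : Ω → ι} (hX : ∀ i, MeasurableSet (X ⁻¹' {i}))
    {B : Set Ω} {e : ℝ≥0∞} (h : ∀ i, P (X ⁻¹' {i} ∩ B) ≤ e * P (X ⁻¹' {i})) : P B ≤ e :=
  calc P B ≤ P (⋃ i, X ⁻¹' {i} ∩ B) := measure_mono fun ω hω => Set.mem_iUnion.2 ⟨X ω, rfl, hω⟩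
    _ ≤ ∑' i, e * P (X ⁻¹' {i}) := (measure_iUnion_le _).trans (ENNReal.tsum_le_tsum h)
    _ = e * P (⋃ i, X ⁻¹' {i}) := by
      rw [ENNReal.tsum_mul_left, measure_iUnion (pairwise_disjoint_fiber X) hX]
    _ ≤ e := mul_le_of_le_one_right' prob_le_one

theorem eq_get_of_history_eq_take {D : Type*} {x : ℕ → D} {l : List D} {m : ℕ}
    (h : history x m = l.take m) {i : Fin l.length} (hi : (i : ℕ) < m) : x i = l.get i := by
  have hget := congrArg (fun l => l[(i : ℕ)]?) h
  simpa [history, hi] using hget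

theorem history_succ_eq_take_succ_iff {D : Type*} {x : ℕ → D} {l : List D} {m : ℕ}
    (hm : m < l.length) :
    history x (m + 1) = l.take (m + 1) ↔ history x m = l.take m ∧ x m = l.get ⟨m, hm⟩ := by
  rw [history_succ, List.take_succ_eq_append_getElem hm, ← List.concat_eq_append,
    ← List.concat_eq_append, List.concat_inj]
  rfl

section Measurability

variable {D Ω : Type*} {noiseVar : D → ℝ} {f : D → Ω → ℝ} {w : ℕ → Ω → ℝ}
  {x : ℕ → Ω → D} {y : ℕ → Ω → ℝ}

theorem exists_preimage_eq_of_causal {t : ℕ} {s : Set Ω}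
    (hs : MeasurableSet[⨆ i : Fin t, MeasurableSpace.comap (y i) inferInstance] s) :
    ∃ S : Set (Fin t → ℝ), MeasurableSet S ∧ (fun ω (i : Fin t) => y i ω) ⁻¹' S = s := by
  have hcomap : (⨆ i : Fin t, MeasurableSpace.comap (y i) inferInstance) =
      MeasurableSpace.comap (fun ω (i : Fin t) => y i ω) MeasurableSpace.pi := by
    rw [MeasurableSpace.pi, MeasurableSpace.comap_iSup]
    simp only [MeasurableSpace.comap_comp]
    rfl
  rwa [hcomap] at hs

theorem measurableSet_history_eq_take
    (hobs : ∀ t ω, y t ω = f (x t ω) ω + √(noiseVar (x t ω)) * w t ω)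
    (hcausal : ∀ t d, MeasurableSet[⨆ s : Fin t, MeasurableSpace.comap (y s) inferInstance]
      {ω | x t ω = d}) (l : List D) {m : ℕ} (hm : m ≤ l.length) :
    MeasurableSet[MeasurableSpace.comap (fun ω i => observation noiseVar f w l i ω) inferInstance]
      {ω | history (fun t => x t ω) m = l.take m} := by
  set 𝒢 := MeasurableSpace.comap (fun ω i => observation noiseVar f w l i ω) inferInstance
  induction m with
  | zero => simp [history]
  | succ m ih =>
    obtain ⟨S, hS, hSx⟩ := exists_preimage_eq_of_causal (hcausal m (l.get ⟨m, hm⟩))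
    let O : Ω → Fin m → ℝ := fun ω s => observation noiseVar f w l ⟨s, s.2.trans hm⟩ ω
    have hO : Measurable[𝒢] O := (measurable_pi_lambda (fun (v : Fin l.length → ℝ) (s : Fin m) =>
      v ⟨s, s.2.trans hm⟩) fun _ => measurable_pi_apply _).comp (comap_measurable _)
    have hOy : ∀ ω, history (fun t => x t ω) m = l.take m → O ω = fun s : Fin m => y s ω := by
      intro ω hω
      funext s
      rw [hobs, eq_get_of_history_eq_take hω (i := ⟨s, s.2.trans hm⟩) s.2]
      rfl
    have hsplit : {ω | history (fun t => x t ω) (m + 1) = l.take (m + 1)} =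
        {ω | history (fun t => x t ω) m = l.take m} ∩ O ⁻¹' S := by
      ext ω
      refine (history_succ_eq_take_succ_iff hm).trans (and_congr_right fun hω => ?_)
      rw [Set.mem_preimage, hOy ω hω]
      exact (Set.ext_iff.1 hSx ω).symm
    rw [hsplit]
    exact (ih (by omega)).inter (hO hS)

theorem measurableSet_history_eq
    (hobs : ∀ t ω, y t ω = f (x t ω) ω + √(noiseVar (x t ω)) * w t ω)
    (hcausal : ∀ t d, MeasurableSet[⨆ s : Fin t, MeasurableSpace.comap (y s) inferInstance]
      {ω | x t ω = d}) (l : List D) :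
    MeasurableSet[MeasurableSpace.comap (fun ω i => observation noiseVar f w l i ω) inferInstance]
      {ω | history (fun t => x t ω) l.length = l} := by
  have h := measurableSet_history_eq_take hobs hcausal l le_rfl
  rwa [List.take_length] at h

end Measurability

/-- The event that after `n` queries the posterior mean at `z` is off by more than `s` posterior
standard deviations. -/
def Input.deviationEvent {D Ω : Type*} (A : Input D) (f : D → Ω → ℝ) (x : ℕ → Ω → D)
    (y : ℕ → Ω → ℝ) (s : ℝ) (n : ℕ) (z : D) : Set Ω :=
  {ω | s * postStd A.kernel A.noiseVar (history (fun t => x t ω) n) z <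
    |f z ω - postMean A.kernel A.noiseVar (history (fun t => x t ω) n) (fun t => y t ω) z|}

section Deviation

variable {D Ω : Type*} [Fintype D] {mΩ : MeasurableSpace Ω} {P : Measure Ω} {A : Input D}
  {f : D → Ω → ℝ} {w : ℕ → Ω → ℝ} {x : ℕ → Ω → D} {y : ℕ → Ω → ℝ}

theorem history_inter_deviationEvent_subset (hA : A.IsAdmissible) (hrun : IsRun A f w x y) (s : ℝ)
    (l : List D) (z : D) :
    {ω | history (fun t => x t ω) l.length = l} ∩ A.deviationEvent f x y s l.length z ⊆
      predError A.kernel A.noiseVar f w l z ⁻¹' {u | s * postStd A.kernel A.noiseVar l z < |u|} ∩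
        {ω | history (fun t => x t ω) l.length = l} := by
  rintro ω ⟨hω : history (fun t => x t ω) l.length = l, hdev⟩
  have hobs (i : Fin l.length) : observation A.noiseVar f w l i ω = y i ω := by
    rw [hrun.observation, observation,
      eq_get_of_history_eq_take (hω.trans l.take_length.symm) i.2]
  rw [Input.deviationEvent, Set.mem_ofPred_eq, hω, postMean_eq_dotProduct hA.posSemidef] at hdev
  refine ⟨?_, hω⟩
  simpa only [Set.mem_preimage, Set.mem_ofPred_eq, predError, hobs] using hdev

variable [IsProbabilityMeasure P] (hA : A.IsAdmissible) (hf : IsCenteredGP A.kernel f P)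
  (hw : IsStdNoise w f P) (hrun : IsRun A f w x y)
include hA hf hw hrun

theorem measure_history_inter_deviationEvent_le {s : ℝ} (hs : 0 ≤ s) (l : List D) (z : D) :
    P ({ω | history (fun t => x t ω) l.length = l} ∩ A.deviationEvent f x y s l.length z) ≤
      ENNReal.ofReal (Real.exp (-(s ^ 2 / 2))) *
        P {ω | history (fun t => x t ω) l.length = l} := by
  obtain ⟨S, hS, hSl⟩ := measurableSet_history_eq hrun.observation hrun.causal l
  refine (measure_mono (history_inter_deviationEvent_subset hA hrun s l z)).trans ?_
  rw [← hSl, (indepFun_predError_observation hf hw hA.posSemidef hA.noiseVar_pos l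
    z).measure_inter_preimage_eq_mul _ _ (measurableSet_lt measurable_const (by fun_prop)) hS]
  gcongr
  exact measure_lt_abs_predError_le hf hw hA.posSemidef hA.noiseVar_pos l z (hA.postVar_pos l z) hs

theorem measure_deviationEvent_le {s : ℝ} (hs : 0 ≤ s) (n : ℕ) (z : D) :
    P (A.deviationEvent f x y s n z) ≤ ENNReal.ofReal (Real.exp (-(s ^ 2 / 2))) := by
  have hlength {l : List D} (hl : l.length ≠ n) :
      (fun ω => history (fun t => x t ω) n) ⁻¹' {l} = ∅ := by
    refine Set.eq_empty_of_forall_notMem fun ω hω => hl ?_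
    rw [← show history (fun t => x t ω) n = l from hω, history, List.length_map,
      List.length_range]
  refine measure_le_of_forall_inter_fiber_le (X := fun ω => history (fun t => x t ω) n)
    (fun l => ?_) fun l => ?_ <;> by_cases hl : l.length = n
  · subst hl
    exact Measurable.comap_le (measurable_pi_lambda _ fun i =>
      measurable_observation hf.measurable hw.measurable l i) _
      (measurableSet_history_eq hrun.observation hrun.causal l)
  · rw [hlength hl]
    exact .empty
  · subst hl
    exact measure_history_inter_deviationEvent_le hA hf hw hrun hs l z
  · simp only [hlength hl, Set.empty_inter, measure_empty, zero_le]

end Deviation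

theorem hasSum_one_div_succ_sq : HasSum (fun t : ℕ => 1 / ((t : ℝ) + 1) ^ 2) (Real.pi ^ 2 / 6) := by
  simpa using (hasSum_nat_add_iff' 1).2 hasSum_zeta_two

theorem exp_neg_sq_sqrt_two_mul_log {u : ℝ} (hu : 1 ≤ u) :
    Real.exp (-(√(2 * Real.log u) ^ 2 / 2)) = 1 / u := by
  rw [Real.sq_sqrt (mul_nonneg two_pos.le (Real.log_nonneg hu)),
    mul_div_cancel_left₀ _ two_ne_zero, Real.exp_neg, Real.exp_log (by linarith), one_div]

/-- The squared width of the confidence intervals after `t + 1` queries that holds simultaneously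
for `N` points and all `t` with probability `1 - δ`: a union bound with weights `1 / (t + 1) ^ 2`,
whose sum is `π ^ 2 / 6`. -/
noncomputable def confidenceWidth (N : ℕ) (δ : ℝ) (t : ℕ) : ℝ :=
  2 * Real.log (N * ((t : ℝ) + 1) ^ 2 * Real.pi ^ 2 / (6 * δ))

theorem exp_neg_sq_sqrt_confidenceWidth {N : ℕ} (hN : 1 ≤ N) {δ : ℝ} (hδ : 0 < δ) (hδ1 : δ < 1)
    (t : ℕ) : Real.exp (-(√(confidenceWidth N δ t) ^ 2 / 2)) =
      6 * δ / (N * Real.pi ^ 2) * (1 / ((t : ℝ) + 1) ^ 2) := by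
  have hN1 : (1 : ℝ) ≤ N := by exact_mod_cast hN
  have hpi : (6 : ℝ) ≤ Real.pi ^ 2 := by nlinarith [Real.pi_gt_three]
  have ht : (1 : ℝ) ≤ ((t : ℝ) + 1) ^ 2 := one_le_pow₀ (by linarith [t.cast_nonneg (α := ℝ)])
  have hNt := one_le_mul_of_one_le_of_one_le hN1 ht
  rw [confidenceWidth, exp_neg_sq_sqrt_two_mul_log ((one_le_div (by positivity)).2 (by nlinarith))]
  field_simp

theorem measure_exists_deviationEvent_le {D Ω : Type*} [Fintype D] [Nonempty D]
    {mΩ : MeasurableSpace Ω} {P : Measure Ω} [IsProbabilityMeasure P] {A : Input D}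
    {f : D → Ω → ℝ} {w : ℕ → Ω → ℝ} {x : ℕ → Ω → D} {y : ℕ → Ω → ℝ} (hA : A.IsAdmissible)
    (hf : IsCenteredGP A.kernel f P) (hw : IsStdNoise w f P) (hrun : IsRun A f w x y) {δ : ℝ}
    (hδ : 0 < δ) (hδ1 : δ < 1) :
    P (⋃ t : ℕ, ⋃ z : D,
      A.deviationEvent f x y √(confidenceWidth (Fintype.card D) δ t) (t + 1) z) ≤
        ENNReal.ofReal δ := by
  have hN0 : (Fintype.card D : ℝ) ≠ 0 := Nat.cast_ne_zero.2 Fintype.card_ne_zero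
  have hsum : HasSum (fun t : ℕ => (Fintype.card D : ℝ) *
      (6 * δ / (Fintype.card D * Real.pi ^ 2) * (1 / ((t : ℝ) + 1) ^ 2))) δ := by
    have hconst : (Fintype.card D : ℝ) *
        (6 * δ / (Fintype.card D * Real.pi ^ 2) * (Real.pi ^ 2 / 6)) = δ := by
      have hpi := Real.pi_ne_zero
      field_simp
    have hseries := (hasSum_one_div_succ_sq.mul_left
      (6 * δ / (Fintype.card D * Real.pi ^ 2))).mul_left (Fintype.card D : ℝ)
    rwa [hconst] at hseries
  have htime (t : ℕ) : P (⋃ z : D,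
      A.deviationEvent f x y √(confidenceWidth (Fintype.card D) δ t) (t + 1) z) ≤
      ENNReal.ofReal (Fintype.card D *
        (6 * δ / (Fintype.card D * Real.pi ^ 2) * (1 / ((t : ℝ) + 1) ^ 2))) := by
    refine (measure_iUnion_fintype_le _ _).trans ((Finset.sum_le_sum fun z _ =>
      measure_deviationEvent_le hA hf hw hrun (Real.sqrt_nonneg _) (t + 1) z).trans_eq ?_)
    rw [exp_neg_sq_sqrt_confidenceWidth Fintype.card_pos hδ hδ1, Finset.sum_const,
      Finset.card_univ, nsmul_eq_mul, ENNReal.ofReal_mul (Nat.cast_nonneg _),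
      ENNReal.ofReal_natCast]
  refine (measure_iUnion_le _).trans ((ENNReal.tsum_le_tsum htime).trans_eq ?_)
  rw [← ENNReal.ofReal_tsum_of_nonneg (fun t => by positivity) hsum.summable, hsum.tsum_eq]

/-! ### Horizon -/

theorem log_one_add_le_two_mul_sqrt {u : ℝ} (hu : 0 ≤ u) : Real.log (1 + u) ≤ 2 * √u := by
  have hsq : 1 + u ≤ (1 + √u) ^ 2 := by nlinarith [Real.sq_sqrt hu, Real.sqrt_nonneg u]
  calc Real.log (1 + u) ≤ Real.log ((1 + √u) ^ 2) := Real.log_le_log (by linarith) hsq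
    _ = 2 * Real.log (1 + √u) := by rw [Real.log_pow, Nat.cast_ofNat]
    _ ≤ 2 * √u := by
      linarith [Real.log_le_sub_one_of_pos (show 0 < 1 + √u by positivity)]

theorem natCast_mul_le_log_of_two_pow_le {u : ℝ} (j : ℕ) (h : (2 : ℝ) ^ j ≤ u) :
    j * 0.6931 ≤ Real.log u :=
  calc j * 0.6931 ≤ j * Real.log 2 := by gcongr; linarith [Real.log_two_gt_d9]
    _ = Real.log (2 ^ j) := by rw [Real.log_pow]
    _ ≤ Real.log u := Real.log_le_log (by positivity) h

theorem succ_sq_le_three_mul_two_pow (m : ℕ) : (m + 1) ^ 2 ≤ 3 * 2 ^ m := by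
  rcases lt_or_ge m 2 with hm | hm
  · interval_cases m <;> norm_num
  induction m, hm using Nat.le_induction with
  | base => norm_num
  | succ m hm ih =>
    rw [pow_succ 2 m]
    nlinarith

/-- The first factor of the horizon condition. It bounds the number of queries that an optimal
choice needs in all epochs up to the one that certifies the accuracy `ε`. -/
noncomputable def queryBound (v γ β δbar ε : ℝ) : ℝ :=
  2 * v * γ * β * (96 * (1 + δbar) ^ 2 / ε ^ 2) +
    1 / Real.log (1 + v⁻¹) * γ * β * (6 * (1 + δbar) ^ 2 / v) +
    2 * (⌈Real.logb 2 (32 * (1 + δbar) ^ 2 / (ε * √v))⌉₊ : ℝ)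

/-- The second factor of the horizon condition. It bounds the number of times that the greedy
choice has to pay for an optimal cover before an epoch is over. -/
noncomputable def greedyFactor (δbar ε : ℝ) (N : ℕ) (β : ℝ) : ℝ :=
  Real.log (16 * (1 + δbar) ^ 2 * N * β / (δbar ^ 2 * ε ^ 2))

section Horizon

variable {v γ β δ δbar ε R : ℝ} {N T m : ℕ}

theorem two_mul_log_three_mul_sq_le_betaT (hN : 2 ≤ N) (hR : 1 ≤ R) (hδ : 0 < δ) (hδ1 : δ < 1)
    (hm : 1 ≤ m) (hT : m ≤ T) : 2 * Real.log (3 * (m : ℝ) ^ 2) ≤ betaT N R δ T := by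
  have hNr : (2 : ℝ) ≤ N := by exact_mod_cast hN
  have _ : (1 : ℝ) ≤ m := by exact_mod_cast hm
  have hTr : (m : ℝ) ≤ T := by exact_mod_cast hT
  have hpi : (9 : ℝ) ≤ Real.pi ^ 2 := by nlinarith [Real.pi_gt_three]
  have hR2 : 1 ≤ R ^ 2 := one_le_pow₀ hR
  refine mul_le_mul_of_nonneg_left (Real.log_le_log (by positivity) ?_) two_pos.le
  rw [le_div_iff₀ (by positivity)]
  calc 3 * (m : ℝ) ^ 2 * (6 * δ) ≤ 3 * (m : ℝ) ^ 2 * 6 := by gcongr; linarith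
    _ = 2 * (m : ℝ) ^ 2 * 1 * 9 := by ring
    _ ≤ N * (T : ℝ) ^ 2 * R ^ 2 * Real.pi ^ 2 := by gcongr

theorem confidenceWidth_le_betaT (hN : 1 ≤ N) (hδ : 0 < δ) {t : ℕ} (h : (t : ℝ) + 1 ≤ R * T) :
    confidenceWidth N δ t ≤ betaT N R δ T := by
  have _ : (1 : ℝ) ≤ N := by exact_mod_cast hN
  have _ := Real.pi_pos
  refine mul_le_mul_of_nonneg_left (Real.log_le_log (by positivity) ?_) two_pos.le
  calc (N : ℝ) * ((t : ℝ) + 1) ^ 2 * Real.pi ^ 2 / (6 * δ)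
      ≤ N * (R * T) ^ 2 * Real.pi ^ 2 / (6 * δ) := by gcongr
    _ = N * (T : ℝ) ^ 2 * R ^ 2 * Real.pi ^ 2 / (6 * δ) := by ring

theorem six_mul_le_queryBound (hv : 0 < v) (hε : 0 < ε) (hδbar : 0 ≤ δbar)
    (hε1 : ε ≤ 4 * (1 + δbar)) (hβ : 0 ≤ β) (hγ : 1 / 2 * Real.log (1 + v⁻¹) ≤ γ) :
    6 * β ≤ queryBound v γ β δbar ε := by
  set s := v⁻¹ with hs
  set ℓ := Real.log (1 + s)
  have hs0 : 0 < s := inv_pos.2 hv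
  have hvs : v * s = 1 := mul_inv_cancel₀ hv.ne'
  have hℓ0 : 0 < ℓ := Real.log_pos (by linarith)
  have hγ0 : 0 < γ := by linarith
  have hvγ : 1 / (2 + s) ≤ v * γ := by
    have hlow := Real.le_log_one_add_of_nonneg hs0.le
    calc 1 / (2 + s) = v * (1 / 2 * (2 * s / (s + 2))) := by
          field_simp
          linear_combination -(s + 2) * hvs
      _ ≤ v * γ := by gcongr; linarith
  have hfirst : 12 / (2 + s) ≤ 2 * v * γ * (96 * (1 + δbar) ^ 2 / ε ^ 2) := by
    have hratio : 6 ≤ 96 * (1 + δbar) ^ 2 / ε ^ 2 := by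
      rw [le_div_iff₀ (by positivity)]
      nlinarith
    calc 12 / (2 + s) = 2 * (1 / (2 + s)) * 6 := by ring
      _ ≤ 2 * (v * γ) * (96 * (1 + δbar) ^ 2 / ε ^ 2) := by gcongr
      _ = _ := by ring
  have hsecond : 3 * s ≤ 1 / ℓ * γ * (6 * (1 + δbar) ^ 2 / v) := by
    have hgain : 1 / 2 ≤ 1 / ℓ * γ := by
      rwa [one_div_mul_eq_div, le_div_iff₀ hℓ0]
    calc 3 * s = 1 / 2 * (6 * 1 ^ 2 / v) := by rw [hs]; ring
      _ ≤ _ := by gcongr; linarith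
  have hsum : 6 ≤ 12 / (2 + s) + 3 * s := by
    rw [div_add' _ _ _ (by positivity), le_div_iff₀ (by positivity)]
    nlinarith
  rw [queryBound]
  calc 6 * β ≤ (2 * v * γ * (96 * (1 + δbar) ^ 2 / ε ^ 2) +
        1 / ℓ * γ * (6 * (1 + δbar) ^ 2 / v)) * β := by gcongr; linarith
    _ ≤ _ := by
      rw [add_mul]
      linarith [Nat.cast_nonneg (α := ℝ) ⌈Real.logb 2 (32 * (1 + δbar) ^ 2 / (ε * √v))⌉₊]

theorem one_le_sq_div_sq (hδbar : 0 < δbar) (hε : 0 < ε) (hε2 : δbar * ε ≤ 4 * (1 + δbar)) :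
    1 ≤ 16 * (1 + δbar) ^ 2 / (δbar ^ 2 * ε ^ 2) := by
  rw [one_le_div (by positivity)]
  nlinarith [pow_le_pow_left₀ (by positivity) hε2 2]

theorem log_two_mul_le_greedyFactor (hN : 2 ≤ N) (hδbar : 0 < δbar) (hε : 0 < ε)
    (hε2 : δbar * ε ≤ 4 * (1 + δbar)) (hβ : 0 < β) :
    Real.log (2 * β) ≤ greedyFactor δbar ε N β := by
  have hNr : (2 : ℝ) ≤ N := by exact_mod_cast hN
  refine Real.log_le_log (by positivity) ?_
  calc 2 * β ≤ 1 * (N * β) := by rw [one_mul]; gcongr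
    _ ≤ 16 * (1 + δbar) ^ 2 / (δbar ^ 2 * ε ^ 2) * (N * β) := by
      gcongr
      exact one_le_sq_div_sq hδbar hε hε2
    _ = _ := by ring

theorem HorizonCondition.mul_le (h : HorizonCondition v γ β δbar ε N T) (hN : 2 ≤ N)
    (hv : 0 < v) (hε : 0 < ε) (hδbar : 0 < δbar) (hε1 : ε ≤ 4 * (1 + δbar))
    (hε2 : δbar * ε ≤ 4 * (1 + δbar)) (hγ : 1 / 2 * Real.log (1 + v⁻¹) ≤ γ) {b : ℝ} {j : ℕ}
    (hb : 0 < b) (hbβ : b ≤ β) (hj : (2 : ℝ) ^ j ≤ 2 * b) : 6 * b * (j * 0.6931) ≤ T := by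
  have hβ : 0 < β := hb.trans_le hbβ
  have hquery := six_mul_le_queryBound hv hε hδbar.le hε1 hβ.le hγ
  have hlog := natCast_mul_le_log_of_two_pow_le j (hj.trans (by linarith : 2 * b ≤ 2 * β))
  refine le_trans ?_ h
  exact mul_le_mul ((mul_le_mul_of_nonneg_left hbβ (by norm_num)).trans hquery)
    (hlog.trans (log_two_mul_le_greedyFactor hN hδbar hε hε2 hβ)) (by positivity)
    ((mul_nonneg (by norm_num) hβ.le).trans hquery)

-- The condition bounds `T` below in terms of `betaT`, which grows with `T`; two rounds suffice.
theorem HorizonCondition.twenty_le_betaT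
    (h : HorizonCondition v γ (betaT N R δ T) δbar ε N T) (hT : 1 ≤ T) (hN : 2 ≤ N)
    (hR : 1 ≤ R) (hδ : 0 < δ) (hδ1 : δ < 1) (hv : 0 < v) (hε : 0 < ε) (hδbar : 0 < δbar)
    (hε1 : ε ≤ 4 * (1 + δbar)) (hε2 : δbar * ε ≤ 4 * (1 + δbar))
    (hγ : 1 / 2 * Real.log (1 + v⁻¹) ≤ γ) : 20 ≤ betaT N R δ T := by
  have hTstep {b : ℝ} (j : ℕ) (hb : 0 < b) (hbβ : b ≤ betaT N R δ T)
      (hj : (2 : ℝ) ^ j ≤ 2 * b) : 6 * b * (j * 0.6931) ≤ T :=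
    h.mul_le hN hv hε hδbar hε1 hε2 hγ hb hbβ hj
  have hβstep {m : ℕ} (j : ℕ) (hm : 1 ≤ m) (hmT : (m : ℝ) ≤ T)
      (hj : (2 : ℝ) ^ j ≤ 3 * (m : ℝ) ^ 2) : 2 * (j * 0.6931) ≤ betaT N R δ T :=
    (mul_le_mul_of_nonneg_left (natCast_mul_le_log_of_two_pow_le j hj) two_pos.le).trans
      (two_mul_log_three_mul_sq_le_betaT hN hR hδ hδ1 hm (by exact_mod_cast hmT))
  have hβ₀ : 2 ≤ betaT N R δ T := by
    have hlog : (1 : ℝ) ≤ Real.log (3 * ((1 : ℕ) : ℝ) ^ 2) := by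
      rw [Real.le_log_iff_exp_le (by norm_num)]
      norm_num
      linarith [Real.exp_one_lt_d9]
    linarith [two_mul_log_three_mul_sq_le_betaT hN hR hδ hδ1 le_rfl hT]
  have hT₀ := hTstep 2 two_pos hβ₀ (by norm_num)
  have hβ₁ := hβstep (m := 16) 9 (by norm_num) (le_trans (by norm_num) hT₀) (by norm_num)
  have hT₁ := hTstep (b := 12) 4 (by norm_num) (by norm_num at hβ₁; linarith) (by norm_num)
  have hβ₂ := hβstep (m := 199) 16 (by norm_num) (le_trans (by norm_num) hT₁) (by norm_num)
  norm_num at hβ₂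
  linarith

theorem one_le_greedyFactor (hN : 2 ≤ N) (hδbar : 0 < δbar) (hε : 0 < ε)
    (hε2 : δbar * ε ≤ 4 * (1 + δbar)) (hβ : 20 ≤ β) : 1 ≤ greedyFactor δbar ε N β := by
  refine le_trans ?_ (log_two_mul_le_greedyFactor hN hδbar hε hε2 (by linarith))
  rw [Real.le_log_iff_exp_le (by linarith)]
  linarith [Real.exp_one_lt_d9]

end Horizon

section ExistsHorizon

theorem isBigO_betaT_log {N : ℕ} (hN : N ≠ 0) {R δ : ℝ} (hR : R ≠ 0) (hδ : δ ≠ 0) :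
    betaT N R δ =O[atTop] fun T : ℕ => Real.log T := by
  set κ := N * R ^ 2 * Real.pi ^ 2 / (6 * δ) with hκ
  have hκ0 : κ ≠ 0 := by
    have _ := Real.pi_ne_zero
    positivity
  have hbeta : ∀ᶠ T : ℕ in atTop, 2 * (Real.log κ + 2 * Real.log T) = betaT N R δ T := by
    filter_upwards [eventually_ne_atTop 0] with T hT
    have hTr : (T : ℝ) ^ 2 ≠ 0 := pow_ne_zero 2 (Nat.cast_ne_zero.2 hT)
    rw [betaT, show N * (T : ℝ) ^ 2 * R ^ 2 * Real.pi ^ 2 / (6 * δ) = κ * (T : ℝ) ^ 2 by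
      rw [hκ]; ring, Real.log_mul hκ0 hTr, Real.log_pow, Nat.cast_ofNat]
  have hconst : (fun _ : ℕ => Real.log κ) =O[atTop] fun T : ℕ => Real.log T :=
    (Real.isLittleO_const_log_atTop.comp_tendsto tendsto_natCast_atTop_atTop).isBigO
  exact ((hconst.add ((isBigO_refl _ _).const_mul_left 2)).const_mul_left 2).congr' hbeta .rfl

variable {D₀ : Type*} [Finite D₀] [Nonempty D₀] {k₀ : D₀ → D₀ → ℝ}

theorem isBigO_maxInfoGain_log (hk : (Matrix.of k₀).PosSemidef) (h1 : ∀ x, k₀ x x = 1) {v : ℝ}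
    (hv : 0 < v) : maxInfoGain k₀ v =O[atTop] fun T : ℕ => Real.log T := by
  cases nonempty_fintype D₀
  have hvinv := inv_pos.2 hv
  have hconst : (fun _ : ℕ => Real.log (1 + v⁻¹)) =O[atTop] fun T : ℕ => Real.log T :=
    (Real.isLittleO_const_log_atTop.comp_tendsto tendsto_natCast_atTop_atTop).isBigO
  refine IsBigO.trans ?_ ((hconst.add (isBigO_refl _ _)).const_mul_left (Fintype.card D₀ / 2 : ℝ))
  refine .of_norm_eventuallyLE ?_
  filter_upwards [eventually_ge_atTop 1] with T hT
  have hTr : (1 : ℝ) ≤ T := by exact_mod_cast hT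
  rw [Real.norm_of_nonneg ((mul_nonneg (by norm_num) (Real.log_nonneg (by linarith))).trans
    (half_log_le_maxInfoGain hk h1 hv hT))]
  refine (maxInfoGain_le_log hk h1 hv T).trans (mul_le_mul_of_nonneg_left ?_ (by positivity))
  rw [← Real.log_mul (by positivity) (by positivity)]
  refine Real.log_le_log (by positivity) ?_
  rw [add_mul, one_mul, div_eq_inv_mul]
  gcongr

theorem isLittleO_horizon (hk : (Matrix.of k₀).PosSemidef) (h1 : ∀ x, k₀ x x = 1) {v : ℝ}
    (hv : 0 < v) {N : ℕ} (hN : N ≠ 0) {R δ : ℝ} (hR : R ≠ 0) (hδ : δ ≠ 0) (p q z : ℝ) :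
    (fun T : ℕ => (p * (maxInfoGain k₀ v T * betaT N R δ T) + q) * (z * betaT N R δ T)) =o[atTop]
      fun T : ℕ => (T : ℝ) := by
  have hβ := isBigO_betaT_log hN hR hδ
  have hγ := isBigO_maxInfoGain_log hk h1 hv
  have hq : (fun _ : ℕ => q) =O[atTop] fun T : ℕ => Real.log T * Real.log T := by
    have hone : (fun _ : ℕ => (1 : ℝ)) =O[atTop] fun T : ℕ => Real.log T :=
      (Real.isLittleO_const_log_atTop.comp_tendsto tendsto_natCast_atTop_atTop).isBigO
    simpa only [mul_one] using (hone.mul hone).const_mul_left q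
  refine (((((hγ.mul hβ).const_mul_left p).add hq).mul (hβ.const_mul_left z)).trans_isLittleO ?_)
  refine ((Real.isLittleO_pow_log_id_atTop (n := 3)).comp_tendsto
    tendsto_natCast_atTop_atTop).congr_left fun T => ?_
  simp only [Function.comp_apply]
  ring

theorem exists_horizonCondition (hk : (Matrix.of k₀).PosSemidef) (h1 : ∀ x, k₀ x x = 1) {v : ℝ}
    (hv : 0 < v) {N : ℕ} (hN : 2 ≤ N) {R δ δbar ε : ℝ} (hR : 1 ≤ R) (hδ : 0 < δ) (hδ1 : δ < 1) :
    ∃ T : ℕ, 1 ≤ T ∧ HorizonCondition v (maxInfoGain k₀ v T) (betaT N R δ T) δbar ε N T := by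
  set p := 2 * v * (96 * (1 + δbar) ^ 2 / ε ^ 2) +
    1 / Real.log (1 + v⁻¹) * (6 * (1 + δbar) ^ 2 / v) with hp
  set q := 2 * (⌈Real.logb 2 (32 * (1 + δbar) ^ 2 / (ε * √v))⌉₊ : ℝ) with hq
  set z := 16 * (1 + δbar) ^ 2 * N / (δbar ^ 2 * ε ^ 2) with hz
  have hlittle := isLittleO_horizon hk h1 hv (by lia : N ≠ 0) (by linarith : R ≠ 0) hδ.ne' p q z
  obtain ⟨T, hTle, hT⟩ := ((hlittle.bound one_pos).and (eventually_ge_atTop 1)).exists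
  refine ⟨T, hT, ?_⟩
  set γ := maxInfoGain k₀ v T
  set β := betaT N R δ T
  have hℓ0 : 0 < Real.log (1 + v⁻¹) := Real.log_pos (by linarith [inv_pos.2 hv])
  have hγ0 : 0 ≤ γ := by linarith [half_log_le_maxInfoGain hk h1 hv hT]
  have hβ0 : 0 ≤ β := by
    refine le_trans ?_ (two_mul_log_three_mul_sq_le_betaT hN hR hδ hδ1 le_rfl hT)
    exact mul_nonneg two_pos.le (Real.log_nonneg (by norm_num))
  have hquery : queryBound v γ β δbar ε = p * (γ * β) + q := by rw [queryBound, hp, hq]; ring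
  have hgreedy : greedyFactor δbar ε N β = Real.log (z * β) := by
    rw [greedyFactor, hz, div_mul_eq_mul_div]
  calc queryBound v γ β δbar ε * greedyFactor δbar ε N β
      = (p * (γ * β) + q) * Real.log (z * β) := by rw [hquery, hgreedy]
    _ ≤ (p * (γ * β) + q) * (z * β) := by gcongr; exact Real.log_le_self (by positivity)
    _ ≤ T := by simpa using (le_abs_self _).trans hTle

theorem minHorizon_spec (hk : (Matrix.of k₀).PosSemidef) (h1 : ∀ x, k₀ x x = 1) {v : ℝ}
    (hv : 0 < v) {N : ℕ} (hN : 2 ≤ N) {R δ δbar ε : ℝ} (hR : 1 ≤ R) (hδ : 0 < δ) (hδ1 : δ < 1) :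
    1 ≤ minHorizon k₀ N R δ δbar ε v ∧
      HorizonCondition v (maxInfoGain k₀ v (minHorizon k₀ N R δ δbar ε v))
        (betaT N R δ (minHorizon k₀ N R δ δbar ε v)) δbar ε N (minHorizon k₀ N R δ δbar ε v) :=
  Nat.sInf_mem (exists_horizonCondition hk h1 hv hN hR hδ hδ1)

end ExistsHorizon

section Horizon

variable {v γ β δbar ε : ℝ} {m : ℕ}

theorem succ_le_of_two_pow_le {q : ℝ} (hv : 0 < v) (hq : 0 < q) (hβ : 20 ≤ β)
    (hm : (2 : ℝ) ^ m ≤ 8 * q) :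
    (m : ℝ) + 1 ≤ β * (32 / 3 * v * q ^ 2 + 3 * (v⁻¹ / Real.log (1 + v⁻¹))) := by
  set s := v⁻¹
  set ℓ := Real.log (1 + s)
  have hs : 0 < s := inv_pos.2 hv
  have hℓ : 0 < ℓ := Real.log_pos (by linarith)
  have hratio : 1 ≤ s / ℓ :=
    (one_le_div hℓ).2 (by linarith [Real.log_le_sub_one_of_pos (show 0 < 1 + s by linarith)])
  have hratio_sqrt : √s / 2 ≤ s / ℓ := by
    rw [le_div_iff₀ hℓ]
    calc √s / 2 * ℓ ≤ √s / 2 * (2 * √s) := by gcongr; exact log_one_add_le_two_mul_sqrt hs.le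
      _ = √s * √s := by ring
      _ = s := Real.mul_self_sqrt hs.le
  obtain ⟨x, hx, hqx, hvx⟩ : ∃ x, 0 < x ∧ q = x * √s ∧ v * q ^ 2 = x ^ 2 := by
    refine ⟨√v * q, by positivity, ?_, by rw [mul_pow, Real.sq_sqrt hv.le]⟩
    rw [mul_right_comm, ← Real.sqrt_mul hv.le, mul_inv_cancel₀ hv.ne', Real.sqrt_one, one_mul]
  have hsq : ((m : ℝ) + 1) ^ 2 ≤ (3 * (x + √s)) ^ 2 := by
    calc ((m : ℝ) + 1) ^ 2 ≤ 3 * 2 ^ m := by exact_mod_cast succ_sq_le_three_mul_two_pow m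
      _ ≤ 3 * (8 * (x * √s)) := by rw [← hqx]; gcongr
      _ ≤ (3 * (x + √s)) ^ 2 := by nlinarith [sq_nonneg (x - √s)]
  calc (m : ℝ) + 1 ≤ 3 * (x + √s) := le_of_sq_le_sq hsq (by positivity)
    _ ≤ 20 * (32 / 3 * x ^ 2 + 3 * (s / ℓ)) := by nlinarith [sq_nonneg (x - 1)]
    _ ≤ β * (32 / 3 * x ^ 2 + 3 * (s / ℓ)) := by gcongr
    _ = β * (32 / 3 * v * q ^ 2 + 3 * (s / ℓ)) := by rw [← hvx, mul_assoc (32 / 3) v]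

theorem one_third_le_mul (hv : 1 ≤ v) (hγ : 1 / 2 * Real.log (1 + v⁻¹) ≤ γ) : 1 / 3 ≤ γ * v := by
  have hv0 : 0 < v := by linarith
  have hlow := Real.le_log_one_add_of_nonneg (inv_pos.2 hv0).le
  rw [← div_le_iff₀ hv0]
  calc 1 / 3 / v ≤ 1 / 2 * (2 * v⁻¹ / (v⁻¹ + 2)) := by
        rw [show 1 / 2 * (2 * v⁻¹ / (v⁻¹ + 2)) = 1 / (1 + 2 * v) by field_simp, div_div]
        exact one_div_le_one_div_of_le (by linarith) (by linarith)
    _ ≤ γ := by linarith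

theorem add_two_le_logb (hv : 0 < v) (hv1 : v ≤ 1) (hε : 0 < ε) (hδbar : 0 ≤ δbar)
    (hm : (2 : ℝ) ^ m ≤ 8 * ((1 + δbar) / ε)) :
    (m : ℝ) + 2 ≤ Real.logb 2 (32 * (1 + δbar) ^ 2 / (ε * √v)) := by
  have hsv : √v ≤ 1 := Real.sqrt_le_one.2 hv1
  rw [Real.le_logb_iff_rpow_le one_lt_two (by positivity)]
  calc (2 : ℝ) ^ ((m : ℝ) + 2) = 4 * 2 ^ m := by
        rw [Real.rpow_add two_pos, Real.rpow_natCast, Real.rpow_two]; ring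
    _ ≤ 4 * (8 * ((1 + δbar) / ε)) := by gcongr
    _ = 32 * (1 + δbar) / ε := by ring
    _ ≤ 32 * (1 + δbar) ^ 2 / (ε * √v) := by
      gcongr
      · nlinarith
      · nlinarith

theorem succ_le_add_ceil_logb (hv : 0 < v) (hε : 0 < ε) (hδbar : 0 ≤ δbar)
    (hε1 : ε ≤ 4 * (1 + δbar)) (hβ : 20 ≤ β) (hγ : 1 / 2 * Real.log (1 + v⁻¹) ≤ γ)
    (hm : (2 : ℝ) ^ m ≤ 8 * ((1 + δbar) / ε)) :
    (m : ℝ) + 1 ≤ γ * β * (32 / 3 * v * ((1 + δbar) / ε) ^ 2) +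
      2 * (⌈Real.logb 2 (32 * (1 + δbar) ^ 2 / (ε * √v))⌉₊ : ℝ) := by
  have hℓ : 0 < Real.log (1 + v⁻¹) := Real.log_pos (by linarith [inv_pos.2 hv])
  have hγ0 : 0 < γ := by linarith
  rcases le_total v 1 with hv1 | hv1
  · have hceil := (add_two_le_logb hv hv1 hε hδbar hm).trans (Nat.le_ceil _)
    have hnonneg : 0 ≤ γ * β * (32 / 3 * v * ((1 + δbar) / ε) ^ 2) := by positivity
    linarith [Nat.cast_nonneg (α := ℝ) m]
  · have hq : 1 / 4 ≤ (1 + δbar) / ε := by rw [le_div_iff₀ hε]; linarith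
    refine le_add_of_le_of_nonneg ?_ (by positivity)
    calc (m : ℝ) + 1 ≤ 2 ^ m := by exact_mod_cast Nat.lt_two_pow_self (n := m)
      _ ≤ 8 * ((1 + δbar) / ε) := hm
      _ ≤ 1 / 3 * 20 * (32 / 3 * ((1 + δbar) / ε) ^ 2) := by nlinarith
      _ ≤ γ * v * β * (32 / 3 * ((1 + δbar) / ε) ^ 2) := by
        gcongr
        exact one_third_le_mul hv1 hγ
      _ = _ := by ring

-- Rounding the number of queries up to an integer costs at most one query per epoch.
theorem succ_mul_add_one_le (hv : 0 < v) (hε : 0 < ε) (hδbar : 0 ≤ δbar)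
    (hε1 : ε ≤ 4 * (1 + δbar)) (hβ : 20 ≤ β) (hγ : 1 / 2 * Real.log (1 + v⁻¹) ≤ γ)
    (hm : (2 : ℝ) ^ m ≤ 8 * ((1 + δbar) / ε)) :
    ((m : ℝ) + 1) * (γ + 1) ≤ 2 * v * γ * β * (32 / 3 * ((1 + δbar) / ε) ^ 2) +
      1 / Real.log (1 + v⁻¹) * γ * β * (6 * (1 + δbar) ^ 2 / v) +
      2 * (⌈Real.logb 2 (32 * (1 + δbar) ^ 2 / (ε * √v))⌉₊ : ℝ) := by
  set ℓ := Real.log (1 + v⁻¹)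
  have hℓ : 0 < ℓ := Real.log_pos (by linarith [inv_pos.2 hv])
  have hγ0 : 0 < γ := by linarith
  have hsecond : γ * (β * (3 * (v⁻¹ / ℓ))) ≤ 1 / ℓ * γ * β * (6 * (1 + δbar) ^ 2 / v) :=
    calc γ * (β * (3 * (v⁻¹ / ℓ))) ≤ γ * (β * (6 * (1 + δbar) ^ 2 * (v⁻¹ / ℓ))) := by
          gcongr
          nlinarith
      _ = _ := by ring
  have hmul : γ * ((m : ℝ) + 1) ≤ γ * β * (32 / 3 * v * ((1 + δbar) / ε) ^ 2) +
      γ * (β * (3 * (v⁻¹ / ℓ))) :=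
    (mul_le_mul_of_nonneg_left (succ_le_of_two_pow_le hv (by positivity) hβ hm) hγ0.le).trans_eq
      (by ring)
  linarith [succ_le_add_ceil_logb hv hε hδbar hε1 hβ hγ hm]

theorem sum_ceil_le_queryBound (hv : 0 < v) (hε : 0 < ε) (hδbar : 0 ≤ δbar)
    (hε1 : ε ≤ 4 * (1 + δbar)) (hβ : 20 ≤ β) (hγ : 1 / 2 * Real.log (1 + v⁻¹) ≤ γ)
    (hm : (2 : ℝ) ^ m ≤ 8 * ((1 + δbar) / ε)) :
    ∑ i ∈ Finset.range (m + 1), (⌈2 * γ * (v * β * 4 ^ i + 1 / 2)⌉₊ : ℝ) ≤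
      queryBound v γ β δbar ε := by
  have hℓ : 0 < Real.log (1 + v⁻¹) := Real.log_pos (by linarith [inv_pos.2 hv])
  have hγ0 : 0 < γ := by linarith
  have hterm : ∀ i ∈ Finset.range (m + 1), (⌈2 * γ * (v * β * 4 ^ i + 1 / 2)⌉₊ : ℝ) ≤
      2 * v * γ * β * 4 ^ i + (γ + 1) := fun i _ =>
    (Nat.ceil_lt_add_one (by positivity)).le.trans_eq (by ring)
  have hgeom : ∑ i ∈ Finset.range (m + 1), (4 : ℝ) ^ i ≤ 256 / 3 * ((1 + δbar) / ε) ^ 2 := by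
    have hsq : (4 : ℝ) ^ m ≤ (8 * ((1 + δbar) / ε)) ^ 2 := by
      rw [show (4 : ℝ) = 2 ^ 2 by norm_num, ← pow_mul, mul_comm, pow_mul]
      gcongr
    rw [geom_sum_eq (by norm_num), pow_succ]
    linarith
  calc ∑ i ∈ Finset.range (m + 1), (⌈2 * γ * (v * β * 4 ^ i + 1 / 2)⌉₊ : ℝ)
      ≤ 2 * v * γ * β * ∑ i ∈ Finset.range (m + 1), (4 : ℝ) ^ i + (m + 1) * (γ + 1) := by
        refine (Finset.sum_le_sum hterm).trans_eq ?_
        rw [Finset.sum_add_distrib, ← Finset.mul_sum, Finset.sum_const, Finset.card_range,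
          nsmul_eq_mul, Nat.cast_succ]
    _ ≤ 2 * v * γ * β * (256 / 3 * ((1 + δbar) / ε) ^ 2) +
          (2 * v * γ * β * (32 / 3 * ((1 + δbar) / ε) ^ 2) +
          1 / Real.log (1 + v⁻¹) * γ * β * (6 * (1 + δbar) ^ 2 / v) +
          2 * (⌈Real.logb 2 (32 * (1 + δbar) ^ 2 / (ε * √v))⌉₊ : ℝ)) := by
        gcongr
        exact succ_mul_add_one_le hv hε hδbar hε1 hβ hγ hm
    _ = queryBound v γ β δbar ε := by rw [queryBound]; ring

theorem three_le_mul_sq_div_sq (hδbar : 0 < δbar) (hε : 0 < ε) (hε1 : ε ≤ 4 * (1 + δbar))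
    (hε2 : δbar * ε ≤ 4 * (1 + δbar)) :
    3 ≤ ((1 + δbar) ^ 2 - 1) * (16 * (1 + δbar) ^ 2 / (δbar ^ 2 * ε ^ 2)) := by
  have hone := one_le_sq_div_sq hδbar hε hε2
  set w := 16 * (1 + δbar) ^ 2 / (δbar ^ 2 * ε ^ 2)
  have hsq : 1 ≤ δbar ^ 2 * w := by
    rw [show δbar ^ 2 * w = 16 * (1 + δbar) ^ 2 / ε ^ 2 by simp only [w]; field_simp,
      one_le_div (by positivity)]
    nlinarith
  rcases le_total 1 δbar with h | h <;> nlinarith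

theorem exp_greedyFactor_sub_one {N : ℕ} (hN : 0 < N) (hδbar : 0 < δbar) (hε : 0 < ε)
    (hβ : 0 < β) : Real.exp (greedyFactor δbar ε N β - 1) =
      16 * (1 + δbar) ^ 2 / (δbar ^ 2 * ε ^ 2) * (N * β) / Real.exp 1 := by
  have _ : (0 : ℝ) < N := by exact_mod_cast hN
  rw [Real.exp_sub, greedyFactor, Real.exp_log (by positivity)]
  ring

theorem card_mul_le_exp_greedyFactor {N : ℕ} (hN : 0 < N) (hδbar : 0 < δbar) (hε : 0 < ε)
    (hε1 : ε ≤ 4 * (1 + δbar)) (hε2 : δbar * ε ≤ 4 * (1 + δbar)) (hβ : 0 < β) :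
    N * β ≤ ((1 + δbar) ^ 2 - 1) * Real.exp (greedyFactor δbar ε N β - 1) := by
  rw [exp_greedyFactor_sub_one hN hδbar hε hβ, ← mul_div_assoc, le_div_iff₀ (Real.exp_pos 1)]
  calc N * β * Real.exp 1 ≤ N * β * 3 := by gcongr; linarith [Real.exp_one_lt_d9]
    _ ≤ N * β * (((1 + δbar) ^ 2 - 1) * (16 * (1 + δbar) ^ 2 / (δbar ^ 2 * ε ^ 2))) := by
      gcongr
      exact three_le_mul_sq_div_sq hδbar hε hε1 hε2
    _ = _ := by ring

theorem card_mul_sub_one_le_exp_greedyFactor {N : ℕ} (hN : 0 < N) (hδbar : 0 < δbar) (hε : 0 < ε)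
    (hε1 : ε ≤ 4 * (1 + δbar)) (hε2 : δbar * ε ≤ 4 * (1 + δbar)) (hβ : 20 ≤ β) :
    N * (4 * (1 + δbar) ^ 2 - 1) ≤
      ((1 + δbar) ^ 2 - 1) * Real.exp (greedyFactor δbar ε N β - 1) := by
  have hone := one_le_sq_div_sq hδbar hε hε2
  have hthree := three_le_mul_sq_div_sq hδbar hε hε1 hε2
  rw [exp_greedyFactor_sub_one hN hδbar hε (by linarith), ← mul_div_assoc,
    le_div_iff₀ (Real.exp_pos 1)]
  set w := 16 * (1 + δbar) ^ 2 / (δbar ^ 2 * ε ^ 2)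
  set g := (1 + δbar) ^ 2 - 1 with hg
  have hg0 : 0 < g := by nlinarith
  calc N * (4 * (1 + δbar) ^ 2 - 1) * Real.exp 1 = N * (3 + 4 * g) * Real.exp 1 := by
        rw [hg]; ring
    _ ≤ N * (5 * (g * w)) * 4 := by
      gcongr
      · nlinarith
      · linarith [Real.exp_one_lt_d9]
    _ = g * (w * (N * 20)) := by ring
    _ ≤ g * (w * (N * β)) := by gcongr

end Horizon

/-! ### Schedules -/

theorem mul_le_cumCost {D : Type*} {cost : D → ℝ} {c : ℝ} (hc : ∀ p, c ≤ cost p) (x : ℕ → D)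
    (t : ℕ) : t * c ≤ cumCost cost x t := by
  simpa only [Finset.card_range, nsmul_eq_mul, cumCost] using
    Finset.card_nsmul_le_sum (Finset.range t) (fun i => cost (x i)) c fun i _ => hc (x i)

namespace Input

variable {D Ω : Type*} [Fintype D] {A : Input D} {c δ ε W : ℝ} {C F : ℕ → ℝ} {m : ℕ}

/-- Epoch budgets that certify the accuracy `ε` at cost `W`, where `c` is a lower bound on the cost
of a query. The confidence width of an epoch has to be valid at every time that the budget allows
the epoch to reach. -/
structure IsSchedule (A : Input D) (c δ ε W : ℝ) (C F : ℕ → ℝ) (m : ℕ) : Prop where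
  epochBudget : A.EpochBudget C F
  sq_η₁_lt : A.η₁ ^ 2 < A.β 0
  isFinalEpoch : A.IsFinalEpoch ε m
  totalBudget_le : totalBudget C F (m + 1) ≤ W
  confidenceWidth_le : ∀ i t : ℕ, (t + 1) * c ≤ totalBudget C F (i + 1) →
    confidenceWidth (Fintype.card D) δ t ≤ A.β i

namespace IsSchedule

variable [Nonempty D] (hA : A.IsAdmissible) (h : A.IsSchedule c δ ε W C F m)
include hA h

theorem lt_epoch {x : ℕ → D} {y : ℕ → ℝ} (hg : A.GreedySelection x y) {t : ℕ}
    (ht : W ≤ cumCost A.cost x t) (hM : (A.state x y t).M.Nonempty) :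
    m < (A.state x y t).epoch := by
  by_contra! hle
  have hspent : cumCost A.cost x (t + 1) ≤ W :=
    (h.epochBudget.cumCost_succ_le hA h.sq_η₁_lt hg hM).trans
      ((h.epochBudget.monotone_totalBudget (Nat.succ_le_succ hle)).trans h.totalBudget_le)
  rw [cumCost_succ] at hspent
  linarith [hA.cost_pos (x t)]

variable {f : D → Ω → ℝ} {x : ℕ → Ω → D} {y : ℕ → Ω → ℝ}

theorem confidenceValid (hc : ∀ p, c ≤ A.cost p) {ω : Ω}
    (hg : A.GreedySelection (fun t => x t ω) fun t => y t ω)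
    (hω : ω ∉ ⋃ t : ℕ, ⋃ z : D,
      A.deviationEvent f x y √(confidenceWidth (Fintype.card D) δ t) (t + 1) z) :
    A.ConfidenceValid (fun z => f z ω) (fun t => x t ω) fun t => y t ω := by
  intro t hM z
  simp only [Set.mem_iUnion, not_exists] at hω
  refine (not_lt.1 (hω t z)).trans
    (mul_le_mul_of_nonneg_right (Real.sqrt_le_sqrt ?_) (Real.sqrt_nonneg _))
  refine h.confidenceWidth_le _ t ?_
  calc ((t : ℝ) + 1) * c ≤ cumCost A.cost (fun t => x t ω) (t + 1) := by
        exact_mod_cast mul_le_cumCost hc _ (t + 1)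
    _ ≤ _ := h.epochBudget.cumCost_succ_le hA h.sq_η₁_lt hg hM

theorem ofReal_le_measure_epsAccurate [MeasurableSpace Ω] {P : Measure Ω} [IsProbabilityMeasure P]
    {w : ℕ → Ω → ℝ} (hc : ∀ p, c ≤ A.cost p) (hδ : 0 < δ) (hδ1 : δ < 1)
    (hf : IsCenteredGP A.kernel f P) (hw : IsStdNoise w f P) (hrun : IsRun A f w x y) :
    ENNReal.ofReal (1 - δ) ≤ P {ω | ∀ t, W ≤ cumCost A.cost (fun s => x s ω) t →
      EpsAccurate (fun z => f z ω) ε (A.state (fun s => x s ω) (fun s => y s ω) t) A.task} := by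
  set good := {ω | ∀ t, W ≤ cumCost A.cost (fun s => x s ω) t →
    EpsAccurate (fun z => f z ω) ε (A.state (fun s => x s ω) (fun s => y s ω) t) A.task}
  set bad := ⋃ t : ℕ, ⋃ z : D,
    A.deviationEvent f x y √(confidenceWidth (Fintype.card D) δ t) (t + 1) z
  have hgood : badᶜ ⊆ good := fun ω hω t ht =>
    (h.confidenceValid hA hc (hrun.greedy ω) hω).epsAccurate h.isFinalEpoch
      (h.lt_epoch hA (hrun.greedy ω) ht)
  rw [ENNReal.ofReal_sub _ hδ.le, ENNReal.ofReal_one, tsub_le_iff_right]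
  calc 1 = P Set.univ := measure_univ.symm
    _ ≤ P badᶜ + P bad := by
      rw [← Set.compl_union_self bad]
      exact measure_union_le _ _
    _ ≤ P good + ENNReal.ofReal δ :=
      add_le_add (measure_mono hgood) (measure_exists_deviationEvent_le hA hf hw hrun hδ hδ1)

end IsSchedule

end Input

theorem exists_totalBudget_sequence {p : ℕ → ℝ → ℝ → ℝ → ℝ → Prop}
    (h : ∀ i V, ∃ β C F, p i V β C F) :
    ∃ β C F : ℕ → ℝ, ∀ i, p i (totalBudget C F i) (β i) (C i) (F i) := by
  choose β C F hp using h
  let V : ℕ → ℝ := fun n => Nat.rec 0 (fun i V => V + C i V * F i V) n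
  have hV (i : ℕ) : totalBudget (fun i => C i (V i)) (fun i => F i (V i)) i = V i := by
    induction i with
    | zero => rfl
    | succ i ih => rw [totalBudget_succ, ih]
  exact ⟨fun i => β i (V i), fun i => C i (V i), fun i => F i (V i), fun i => by
    rw [hV]; exact hp i (V i)⟩

theorem eventually_two_mul_log_le {κ : ℝ} (hκ : 0 < κ) (U : ℝ) :
    ∀ᶠ b : ℝ in atTop, ∀ u : ℝ, |u| ≤ U * b ^ 2 → 2 * Real.log (κ * u ^ 2) ≤ b := by
  have hlittle := (isLittleO_pow_exp_pos_mul_atTop 4 (by norm_num : (0 : ℝ) < 1 / 2)).const_mul_left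
    (κ * U ^ 2)
  filter_upwards [hlittle.bound one_pos, eventually_ge_atTop 0] with b hb hb0 u hu
  rcases eq_or_ne u 0 with rfl | hu0
  · simpa using hb0
  rw [one_mul, Real.norm_of_nonneg (by positivity), Real.norm_of_nonneg (Real.exp_pos _).le] at hb
  have hle : κ * u ^ 2 ≤ Real.exp (1 / 2 * b) :=
    calc κ * u ^ 2 = κ * |u| ^ 2 := by rw [sq_abs]
      _ ≤ κ * (U * b ^ 2) ^ 2 := by gcongr
      _ = κ * U ^ 2 * b ^ 4 := by ring
      _ ≤ Real.exp (1 / 2 * b) := hb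
  linarith [(Real.log_le_iff_le_exp (by positivity)).2 hle]

section CoverCost

variable {D₀ : Type*} {K : ℕ} {k₀ : D₀ → D₀ → ℝ} {σ2 c : Fin K → ℝ}

/-- `C` is the cost of a collection of queries after which no posterior variance exceeds `v`. -/
def IsCoverCost (k₀ : D₀ → D₀ → ℝ) (σ2 c : Fin K → ℝ) (v C : ℝ) : Prop :=
  ∃ S : List (D₀ × Fin K), (S.map fun p => c p.2).sum = C ∧
    ∀ z, postVar (fun p q : D₀ × Fin K => k₀ p.1 q.1) (fun p => σ2 p.2) S z ≤ v

theorem sum_map_cost_eq {j : Fin K} {l : List (D₀ × Fin K)} (hl : ∀ p ∈ l, p.2 = j) :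
    (l.map fun p => c p.2).sum = c j * l.length := by
  rw [List.map_congr_left fun p hp => by rw [hl p hp], List.map_const', List.sum_replicate,
    nsmul_eq_mul, mul_comm]

theorem isCoverCost_of_div_le [Fintype D₀] (hk : (Matrix.of k₀).PosSemidef) (hσ : ∀ j, 0 < σ2 j)
    (j : Fin K) {v : ℝ} (hv : 0 < v) {n : ℕ} (hn : σ2 j / v ≤ n) :
    IsCoverCost k₀ σ2 c v (c j * (n * Fintype.card D₀)) := by
  obtain ⟨l, hlen, hl, hpost⟩ := exists_postVar_le_of_div_le hk hσ j hv hn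
  exact ⟨l, by rw [sum_map_cost_eq hl, hlen, Nat.cast_mul], hpost⟩

variable [Nonempty D₀]

theorem isCoverCost_of_maxInfoGain_mul_le [Finite D₀] (hk : (Matrix.of k₀).PosSemidef)
    (hσ : ∀ j, 0 < σ2 j) (j : Fin K) {v : ℝ} (hv : 0 < v) {T n : ℕ} (hn : 1 ≤ n)
    (hnT : n ≤ T) (hgain : 2 * maxInfoGain k₀ (σ2 j) T * (σ2 j / v + 1 / 2) ≤ n) :
    IsCoverCost k₀ σ2 c v (c j * n) := by
  have hrate : 0 ≤ σ2 j / v + 1 / 2 := by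
    have := hσ j
    positivity
  have hγ := maxInfoGain_mono hk (hσ j) hnT
  obtain ⟨l, hlen, hl, hpost⟩ := exists_postVar_le_of_maxInfoGain_mul_le hk hσ j hv hn
    (le_trans (by gcongr) hgain)
  exact ⟨l, by rw [sum_map_cost_eq hl, hlen], hpost⟩

theorem confidenceWidth_le_two_mul_log {N t : ℕ} {δ c₀ V : ℝ} (hN : 0 < N) (hδ : 0 < δ)
    (hc₀ : 0 < c₀) (ht : (t + 1) * c₀ ≤ V) :
    confidenceWidth N δ t ≤ 2 * Real.log (N * Real.pi ^ 2 / (6 * δ * c₀ ^ 2) * V ^ 2) := by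
  have _ : (0 : ℝ) < N := by exact_mod_cast hN
  have _ := Real.pi_pos
  refine mul_le_mul_of_nonneg_left (Real.log_le_log (by positivity) ?_) two_pos.le
  calc (N : ℝ) * ((t : ℝ) + 1) ^ 2 * Real.pi ^ 2 / (6 * δ)
      = N * Real.pi ^ 2 / (6 * δ * c₀ ^ 2) * ((t + 1) * c₀) ^ 2 := by field_simp
    _ ≤ N * Real.pi ^ 2 / (6 * δ * c₀ ^ 2) * V ^ 2 := by gcongr

theorem exists_confidence_parameter [Finite D₀] (hk : (Matrix.of k₀).PosSemidef)
    (hσ : ∀ j, 0 < σ2 j) (hc : ∀ j, 0 < c j) (j : Fin K) {N : ℕ} (hN : 0 < N) {e ρ δ c₀ : ℝ}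
    (he : 0 < e) (hρ : 0 ≤ ρ) (hδ : 0 < δ) (hc₀ : 0 < c₀) (V : ℝ) :
    ∃ β C : ℝ, 20 ≤ β ∧ 0 < C ∧ IsCoverCost k₀ σ2 c (e / β) C ∧
      ∀ t : ℕ, (t + 1) * c₀ ≤ V + C * (1 + ρ * β) → confidenceWidth N δ t ≤ β := by
  cases nonempty_fintype D₀
  set s := σ2 j / e
  have hs : 0 < s := div_pos (hσ j) he
  set d : ℝ := c j * Fintype.card D₀ with hd
  have hd0 : 0 < d := mul_pos (hc j) (by exact_mod_cast Fintype.card_pos)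
  have hκ : 0 < N * Real.pi ^ 2 / (6 * δ * c₀ ^ 2) := by
    have _ : (0 : ℝ) < N := by exact_mod_cast hN
    have _ := Real.pi_pos
    positivity
  obtain ⟨β, hlog, hβ⟩ := ((eventually_two_mul_log_le hκ (|V| + d * (s + 1) * (1 + ρ))).and
    (eventually_ge_atTop 20)).exists
  have hβ1 : 1 ≤ β := by linarith
  set n := ⌈s * β⌉₊
  have _ : (0 : ℝ) < n := by exact_mod_cast Nat.ceil_pos.2 (by positivity : 0 < s * β)
  have hn : (n : ℝ) ≤ (s + 1) * β := by
    linarith [Nat.ceil_lt_add_one (by positivity : 0 ≤ s * β)]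
  have hcover : IsCoverCost k₀ σ2 c (e / β) (n * d) := by
    rw [hd, mul_left_comm]
    refine isCoverCost_of_div_le hk hσ j (by positivity) ?_
    rw [div_div_eq_mul_div, mul_div_right_comm]
    exact Nat.le_ceil _
  refine ⟨β, n * d, hβ, by positivity, hcover, fun t ht =>
    (confidenceWidth_le_two_mul_log hN hδ hc₀ ht).trans (hlog _ ?_)⟩
  calc |V + n * d * (1 + ρ * β)| ≤ |V| + n * d * (1 + ρ * β) :=
        (abs_add_le _ _).trans_eq (by rw [abs_of_nonneg (by positivity : 0 ≤ n * d * (1 + ρ * β))])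
    _ ≤ |V| * β ^ 2 + (s + 1) * β * d * (β + ρ * β) := by
      gcongr
      exact le_mul_of_one_le_right (abs_nonneg V) (one_le_pow₀ hβ1)
    _ = _ := by ring

end CoverCost

theorem Input.epochBudget_of_card_mul_le {D : Type*} [Fintype D] {A : Input D} {C F : ℕ → ℝ} {m : ℕ}
    (hA : A.IsAdmissible) (hC : ∀ i, 0 < C i)
    (hcover : ∀ i, ∃ S, (S.map A.cost).sum = C i ∧ A.IsCover i S) (hF : ∀ i, 1 ≤ F i)
    (hstart : ∀ i, i = 0 ∨ m < i →
      Fintype.card D * A.β i ≤ A.doneLevel i * Real.exp (F i - 1))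
    (hsucc : ∀ i < m, A.β (i + 1) = A.β i ∧
      Fintype.card D * (((1 + A.δbar) ^ 2 / A.r ^ 2 - 1) * A.η (i + 1) ^ 2) ≤
        A.doneLevel (i + 1) * Real.exp (F (i + 1) - 1)) :
    A.EpochBudget C F := by
  have hcard (M : Finset D) : (M.card : ℝ) ≤ Fintype.card D := by
    exact_mod_cast Finset.card_le_univ M
  have hreset (i : ℕ) (hi : i = 0 ∨ m < i) (M : Finset D) (l : List D) :
      A.potential i M l ≤ A.doneLevel i * Real.exp (F i - 1) :=
    (potential_le_card_mul hA i M l).trans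
      ((mul_le_mul_of_nonneg_right (hcard M) (hA.β_pos i).le).trans (hstart i hi))
  refine ⟨hC, hcover, hF, hreset 0 (Or.inl rfl) _ _, fun i M l hdone => ?_⟩
  rcases lt_or_ge i m with hi | hi
  · obtain ⟨hβ, hle⟩ := hsucc i hi
    have hratio : 1 ≤ (1 + A.δbar) ^ 2 / A.r ^ 2 := by
      rw [one_le_div (pow_pos hA.r_pos 2)]
      exact pow_le_pow_left₀ hA.r_pos.le (by linarith [hA.r_lt_one, hA.δbar_pos]) 2
    exact (potential_succ_le_of_epochDone hA hβ hdone).trans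
      ((mul_le_mul_of_nonneg_right (hcard M)
        (mul_nonneg (sub_nonneg.2 hratio) (sq_nonneg _))).trans hle)
  · exact hreset (i + 1) (Or.inr (Nat.lt_succ_of_le hi)) M l

theorem exists_four_mul_pow_le_and_two_pow_le {a ε : ℝ} (hε : 0 < ε)
    (hεa : ε ≤ 4 * a) :
    ∃ m : ℕ, 4 * (a * (1 / 2) ^ m) ≤ ε ∧ (2 : ℝ) ^ m ≤ 8 * (a / ε) := by
  obtain ⟨m, hlow, hup⟩ := exists_nat_pow_near
    (show 1 ≤ 4 * a / ε by rwa [one_le_div hε]) one_lt_two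
  refine ⟨m + 1, ?_, ?_⟩
  · rw [one_div_pow, mul_one_div, ← mul_div_assoc, div_le_iff₀ (by positivity), ← div_le_iff₀' hε]
    exact hup.le
  · calc (2 : ℝ) ^ (m + 1) = 2 * 2 ^ m := pow_succ' 2 m
      _ ≤ 2 * (4 * a / ε) := by gcongr
      _ = 8 * (a / ε) := by ring

section ChooseNoise

variable {D₀ : Type*} {K : ℕ} {k₀ : D₀ → D₀ → ℝ} {σ2 c : Fin K → ℝ} {δbar : ℝ} {β : ℕ → ℝ}

theorem chooseNoiseInput_η (task : Task) (i : ℕ) :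
    (chooseNoiseInput k₀ σ2 c task δbar β).η i = (1 / 2) ^ i :=
  one_mul _

theorem chooseNoiseInput_doneLevel (task : Task) (i : ℕ) :
    (chooseNoiseInput k₀ σ2 c task δbar β).doneLevel i =
      ((1 + δbar) ^ 2 - 1) * ((1 / 2) ^ i) ^ 2 := by
  rw [Input.doneLevel, chooseNoiseInput_η]
  rfl

theorem isAdmissible_chooseNoiseInput (hk : (Matrix.of k₀).PosSemidef) (h1 : ∀ x, k₀ x x = 1)
    (hσ : ∀ j, 0 < σ2 j) (hc : ∀ j, 0 < c j)
    (hsub : SubmodularVarReduction (fun p q : D₀ × Fin K => k₀ p.1 q.1) fun p => σ2 p.2)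
    (hδbar : 0 < δbar) (hβ : ∃ b > 0, ∀ i, b ≤ β i) (task : Task) :
    (chooseNoiseInput k₀ σ2 c task δbar β).IsAdmissible where
  posSemidef := posSemidef_comp_fst hk
  kernel_self p := h1 p.1
  noiseVar_pos p := hσ p.2
  cost_pos p := hc p.2
  submodular := hsub
  δbar_pos := hδbar
  r_pos := by norm_num [chooseNoiseInput]
  r_lt_one := by norm_num [chooseNoiseInput]
  η₁_pos := one_pos
  exists_le_β := hβ

theorem IsCoverCost.exists_isCover {i : ℕ} {C : ℝ} (hβ : 0 < β i)
    (h : IsCoverCost k₀ σ2 c (((1 / 2) ^ i) ^ 2 / β i) C) (task : Task) :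
    ∃ S, (S.map (chooseNoiseInput k₀ σ2 c task δbar β).cost).sum = C ∧
      (chooseNoiseInput k₀ σ2 c task δbar β).IsCover i S := by
  obtain ⟨S, hC, hS⟩ := h
  refine ⟨S, hC, fun z => ?_⟩
  rw [chooseNoiseInput_η]
  exact (le_div_iff₀' hβ).1 (hS z)

variable [Fintype D₀]

/-- Confidence parameter `β`, cost `C` of a cover and greedy factor `F` of epoch `i`, when the
earlier epochs may cost `V`. The epochs up to `m`, which certify the accuracy `ε`, use the constant
parameter `b` and the covers of cost `C₀`; the later ones only have to keep the confidence bounds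
valid, and their parameter absorbs the cost of reaching them. -/
structure IsEpochChoice (k₀ : D₀ → D₀ → ℝ) (σ2 c : Fin K → ℝ) (δbar ε δ c₀ b : ℝ) (C₀ : ℕ → ℝ)
    (m i : ℕ) (V β C F : ℝ) : Prop where
  twenty_le : 20 ≤ β
  cost_pos : 0 < C
  isCoverCost : IsCoverCost k₀ σ2 c (((1 / 2) ^ i) ^ 2 / β) C
  early : i ≤ m → β = b ∧ C = C₀ i ∧ F = greedyFactor δbar ε (Fintype.card (D₀ × Fin K)) b
  late : m < i →
    F = 1 + Fintype.card (D₀ × Fin K) / (((1 + δbar) ^ 2 - 1) * ((1 / 2) ^ i) ^ 2) * β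
  confidenceWidth_le : m < i → ∀ t : ℕ, (t + 1) * c₀ ≤ V + C * F →
    confidenceWidth (Fintype.card (D₀ × Fin K)) δ t ≤ β

variable {ε δ c₀ b : ℝ} {C₀ : ℕ → ℝ} {m : ℕ}

theorem exists_isEpochChoice [Nonempty D₀] (hk : (Matrix.of k₀).PosSemidef) (hσ : ∀ j, 0 < σ2 j)
    (hc : ∀ j, 0 < c j) (j : Fin K) (hδbar : 0 < δbar) (hδ : 0 < δ) (hc₀ : 0 < c₀) (hb : 20 ≤ b)
    (hC₀ : ∀ i ≤ m, 0 < C₀ i ∧ IsCoverCost k₀ σ2 c (((1 / 2) ^ i) ^ 2 / b) (C₀ i))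
    (i : ℕ) (V : ℝ) : ∃ β C F, IsEpochChoice k₀ σ2 c δbar ε δ c₀ b C₀ m i V β C F := by
  rcases le_or_gt i m with hi | hi
  · exact ⟨b, C₀ i, _, hb, (hC₀ i hi).1, (hC₀ i hi).2, fun _ => ⟨rfl, rfl, rfl⟩,
      fun h => absurd hi h.not_ge, fun h => absurd hi h.not_ge⟩
  · have _ : Nonempty (Fin K) := ⟨j⟩
    have hθ : 0 < (1 + δbar) ^ 2 - 1 := by nlinarith
    obtain ⟨β, C, hβ, hC, hcover, hconf⟩ := exists_confidence_parameter hk hσ hc j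
      (Fintype.card_pos (α := D₀ × Fin K)) (e := ((1 / 2) ^ i) ^ 2)
      (ρ := Fintype.card (D₀ × Fin K) / (((1 + δbar) ^ 2 - 1) * ((1 / 2) ^ i) ^ 2))
      (by positivity) (by positivity) hδ hc₀ V
    exact ⟨β, C, _, hβ, hC, hcover, fun h => absurd h hi.not_ge, fun _ => rfl, fun _ => hconf⟩

section Schedule

variable {C F : ℕ → ℝ}
  (h : ∀ i, IsEpochChoice k₀ σ2 c δbar ε δ c₀ b C₀ m i (totalBudget C F i) (β i) (C i) (F i))
include h

theorem totalBudget_succ_eq_of_isEpochChoice :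
    totalBudget C F (m + 1) = (∑ i ∈ Finset.range (m + 1), C₀ i) *
      greedyFactor δbar ε (Fintype.card (D₀ × Fin K)) b := by
  rw [totalBudget, Finset.sum_mul]
  refine Finset.sum_congr rfl fun i hi => ?_
  obtain ⟨-, hC, hF⟩ := (h i).early (Finset.mem_range_succ_iff.1 hi)
  rw [hC, hF]

variable (hcard : 2 ≤ Fintype.card (D₀ × Fin K)) (hδbar : 0 < δbar) (hε : 0 < ε)
  (hε1 : ε ≤ 4 * (1 + δbar)) (hε2 : δbar * ε ≤ 4 * (1 + δbar))
include hcard hδbar hε hε2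

theorem one_le_of_isEpochChoice (i : ℕ) : 1 ≤ F i := by
  rcases le_or_gt i m with hi | hi
  · obtain ⟨hβ, -, hF⟩ := (h i).early hi
    rw [hF]
    exact one_le_greedyFactor hcard hδbar hε hε2 (hβ ▸ (h i).twenty_le)
  · have hβ := (h i).twenty_le
    have hθ : 0 < (1 + δbar) ^ 2 - 1 := by nlinarith
    rw [(h i).late hi]
    exact le_add_of_nonneg_right (by positivity)

include hε1

theorem epochBudget_of_isEpochChoice {task : Task}
    (hA : (chooseNoiseInput k₀ σ2 c task δbar β).IsAdmissible) :
    (chooseNoiseInput k₀ σ2 c task δbar β).EpochBudget C F := by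
  have hN : 0 < Fintype.card (D₀ × Fin K) := by lia
  have hearly {i : ℕ} (hi : i ≤ m) : β i = b ∧
      F i = greedyFactor δbar ε (Fintype.card (D₀ × Fin K)) (β i) := by
    obtain ⟨hβ, -, hF⟩ := (h i).early hi
    exact ⟨hβ, by rw [hF, hβ]⟩
  refine Input.epochBudget_of_card_mul_le (m := m) hA (fun i => (h i).cost_pos)
    (fun i => (h i).isCoverCost.exists_isCover (hA.β_pos i) task)
    (one_le_of_isEpochChoice h hcard hδbar hε hε2) ?_ fun i hi => ⟨?_, ?_⟩
  · rintro i (rfl | hi) <;> rw [chooseNoiseInput_doneLevel]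
    · rw [pow_zero, one_pow, mul_one, (hearly m.zero_le).2]
      exact card_mul_le_exp_greedyFactor hN hδbar hε hε1 hε2 (hA.β_pos 0)
    · have hθ : 0 < ((1 + δbar) ^ 2 - 1) * ((1 / 2) ^ i) ^ 2 :=
        mul_pos (by nlinarith) (by positivity)
      rw [← div_le_iff₀' hθ, (h i).late hi, add_sub_cancel_left, ← div_mul_eq_mul_div]
      exact (lt_add_one _).le.trans (Real.add_one_le_exp _)
  · exact (hearly hi).1.trans (hearly hi.le).1.symm
  · rw [chooseNoiseInput_doneLevel, chooseNoiseInput_η, (hearly hi).2]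
    calc (Fintype.card (D₀ × Fin K) : ℝ) *
          (((1 + δbar) ^ 2 / (1 / 2) ^ 2 - 1) * ((1 / 2) ^ (i + 1)) ^ 2)
        = Fintype.card (D₀ × Fin K) * (4 * (1 + δbar) ^ 2 - 1) * ((1 / 2) ^ (i + 1)) ^ 2 := by ring
      _ ≤ ((1 + δbar) ^ 2 - 1) *
            Real.exp (greedyFactor δbar ε (Fintype.card (D₀ × Fin K)) (β (i + 1)) - 1) *
            ((1 / 2) ^ (i + 1)) ^ 2 := mul_le_mul_of_nonneg_right
          (card_mul_sub_one_le_exp_greedyFactor hN hδbar hε hε1 hε2 (h (i + 1)).twenty_le)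
          (sq_nonneg _)
      _ = _ := by ring

theorem isSchedule_of_isEpochChoice {task : Task} {W : ℝ}
    (hA : (chooseNoiseInput k₀ σ2 c task δbar β).IsAdmissible)
    (hm : 4 * ((1 + δbar) * (1 / 2) ^ m) ≤ ε)
    (hW : (∑ i ∈ Finset.range (m + 1), C₀ i) *
      greedyFactor δbar ε (Fintype.card (D₀ × Fin K)) b ≤ W)
    (hb : ∀ t : ℕ, (t + 1) * c₀ ≤ W → confidenceWidth (Fintype.card (D₀ × Fin K)) δ t ≤ b) :
    (chooseNoiseInput k₀ σ2 c task δbar β).IsSchedule c₀ δ ε W C F m := by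
  have hbudget := epochBudget_of_isEpochChoice h hcard hδbar hε hε1 hε2 hA
  have htotal := (totalBudget_succ_eq_of_isEpochChoice h).trans_le hW
  have hβ (i : ℕ) (hi : i ≤ m) : β i = b := ((h i).early hi).1
  refine ⟨hbudget, ?_, ⟨fun i hi => (hβ i hi).trans (hβ m le_rfl).symm, ?_⟩, htotal, ?_⟩
  · calc (1 : ℝ) ^ 2 < 20 := by norm_num
      _ ≤ β 0 := (h 0).twenty_le
  · rwa [chooseNoiseInput_η]
  · intro i t ht
    change _ ≤ β i
    rcases le_or_gt i m with hi | hi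
    · rw [hβ i hi]
      exact hb t (ht.trans ((hbudget.monotone_totalBudget (Nat.succ_le_succ hi)).trans htotal))
    · exact (h i).confidenceWidth_le hi t (by rwa [← totalBudget_succ])

end Schedule

end ChooseNoise

section Assembly

variable {D₀ : Type*} {K : ℕ} {k₀ : D₀ → D₀ → ℝ} {σ2 c : Fin K → ℝ}

theorem isCoverCost_half_pow_of_maxInfoGain_mul_le [Finite D₀] [Nonempty D₀]
    (hk : (Matrix.of k₀).PosSemidef) (hσ : ∀ j, 0 < σ2 j) (j : Fin K) {b : ℝ} (hb : 0 < b)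
    {T n i : ℕ} (hn : 1 ≤ n) (hnT : n ≤ T)
    (hgain : 2 * maxInfoGain k₀ (σ2 j) T * (σ2 j * b * 4 ^ i + 1 / 2) ≤ n) :
    IsCoverCost k₀ σ2 c (((1 / 2) ^ i) ^ 2 / b) (c j * n) := by
  refine isCoverCost_of_maxInfoGain_mul_le hk hσ j (by positivity) hn hnT ?_
  have hpow : ((1 / 2 : ℝ) ^ i) ^ 2 = (4 ^ i)⁻¹ := by
    rw [← pow_mul, mul_comm i, pow_mul, ← inv_pow]
    norm_num
  rwa [div_div_eq_mul_div, hpow, div_inv_eq_mul]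

theorem exists_isSchedule [Fintype D₀] [Nonempty D₀] (hcard : 2 ≤ Fintype.card (D₀ × Fin K))
    (hk : (Matrix.of k₀).PosSemidef) (h1 : ∀ x, k₀ x x = 1) (hσ : ∀ j, 0 < σ2 j)
    (hc : ∀ j, 0 < c j)
    (hsub : SubmodularVarReduction (fun p q : D₀ × Fin K => k₀ p.1 q.1) fun p => σ2 p.2)
    {ε δ δbar c₀ R : ℝ} (hε : 0 < ε) (hδ : 0 < δ) (hδ1 : δ < 1) (hδbar : 0 < δbar)
    (hε1 : ε ≤ 4 * (1 + δbar)) (hε2 : δbar * ε ≤ 4 * (1 + δbar)) (hc₀ : 0 < c₀) (hR : 1 ≤ R)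
    (j : Fin K) (hj : c j ≤ R * c₀) {T : ℕ} (hT : 1 ≤ T)
    (h : HorizonCondition (σ2 j) (maxInfoGain k₀ (σ2 j) T)
      (betaT (Fintype.card (D₀ × Fin K)) R δ T) δbar ε (Fintype.card (D₀ × Fin K)) T) :
    ∃ (β C F : ℕ → ℝ) (m : ℕ), (∀ i, 20 ≤ β i) ∧ ∀ task,
      (chooseNoiseInput k₀ σ2 c task δbar β).IsSchedule c₀ δ ε (c j * T) C F m := by
  set b := betaT (Fintype.card (D₀ × Fin K)) R δ T
  have hγ := half_log_le_maxInfoGain hk h1 (hσ j) hT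
  have hb : 20 ≤ b := h.twenty_le_betaT hT hcard hR hδ hδ1 (hσ j) hε hδbar hε1 hε2 hγ
  obtain ⟨m, hm, hpow⟩ :=
    exists_four_mul_pow_le_and_two_pow_le (a := 1 + δbar) hε hε1
  set n : ℕ → ℕ := fun i => ⌈2 * maxInfoGain k₀ (σ2 j) T * (σ2 j * b * 4 ^ i + 1 / 2)⌉₊
  have hfactor := one_le_greedyFactor hcard hδbar hε hε2 hb
  have hsum : (∑ i ∈ Finset.range (m + 1), (n i : ℝ)) *
      greedyFactor δbar ε (Fintype.card (D₀ × Fin K)) b ≤ T :=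
    (mul_le_mul_of_nonneg_right (sum_ceil_le_queryBound (hσ j) hε hδbar.le hε1 hb hγ hpow)
      (zero_le_one.trans hfactor)).trans h
  have hn (i : ℕ) (hi : i ≤ m) : n i ≤ T := by
    have hle : (n i : ℝ) ≤ T :=
      calc (n i : ℝ) ≤ ∑ i ∈ Finset.range (m + 1), (n i : ℝ) :=
            Finset.single_le_sum (f := fun i => (n i : ℝ)) (fun _ _ => Nat.cast_nonneg _)
              (Finset.mem_range_succ_iff.2 hi)
        _ ≤ _ := le_mul_of_one_le_right (by positivity) hfactor
        _ ≤ T := hsum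
    exact_mod_cast hle
  have hn_pos (i : ℕ) : 0 < n i := by
    have hσj := hσ j
    have hlog : 0 < Real.log (1 + (σ2 j)⁻¹) := Real.log_pos (by linarith [inv_pos.2 hσj])
    have _ : 0 < maxInfoGain k₀ (σ2 j) T := by linarith
    exact Nat.ceil_pos.2 (by positivity)
  obtain ⟨β, C, F, hchoice⟩ := exists_totalBudget_sequence
    (exists_isEpochChoice (m := m) (C₀ := fun i => c j * n i) (ε := ε) hk hσ hc j hδbar hδ hc₀ hb
      fun i hi => ⟨mul_pos (hc j) (Nat.cast_pos.2 (hn_pos i)),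
        isCoverCost_half_pow_of_maxInfoGain_mul_le hk hσ j (by linarith) (hn_pos i) (hn i hi)
          (Nat.le_ceil _)⟩)
  have hβ (i : ℕ) : 20 ≤ β i := (hchoice i).twenty_le
  refine ⟨β, C, F, m, hβ, fun task => isSchedule_of_isEpochChoice hchoice hcard hδbar hε hε1 hε2
    (isAdmissible_chooseNoiseInput hk h1 hσ hc hsub hδbar ⟨20, by norm_num, hβ⟩ task) hm ?_ ?_⟩
  · rw [← Finset.mul_sum, mul_assoc]
    exact mul_le_mul_of_nonneg_left hsum (hc j).le
  · intro t ht
    refine confidenceWidth_le_betaT (by lia) hδ (le_of_mul_le_mul_right ?_ hc₀)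
    calc (t + 1) * c₀ ≤ c j * T := ht
      _ ≤ R * c₀ * T := by gcongr
      _ = R * T * c₀ := by ring

theorem exists_isSchedule_iInf [Fintype D₀] [Nonempty D₀] [Nonempty (Fin K)]
    (hcard : 2 ≤ Fintype.card (D₀ × Fin K))
    (hk : (Matrix.of k₀).PosSemidef) (h1 : ∀ x, k₀ x x = 1) (hσ : ∀ j, 0 < σ2 j)
    (hc : ∀ j, 0 < c j)
    (hsub : SubmodularVarReduction (fun p q : D₀ × Fin K => k₀ p.1 q.1) fun p => σ2 p.2)
    {ε δ δbar : ℝ} (hε : 0 < ε) (hδ : 0 < δ) (hδ1 : δ < 1) (hδbar : 0 < δbar)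
    (hε1 : ε ≤ 4 * (1 + δbar)) (hε2 : δbar * ε ≤ 4 * (1 + δbar)) :
    ∃ (β C F : ℕ → ℝ) (m : ℕ), (∀ i, 20 ≤ β i) ∧ ∀ task,
      (chooseNoiseInput k₀ σ2 c task δbar β).IsSchedule (⨅ j, c j) δ ε
        (⨅ k, c k * (minHorizon k₀ (Fintype.card (D₀ × Fin K)) ((⨆ j, c j) / ⨅ j, c j) δ δbar ε
          (σ2 k) : ℝ)) C F m := by
  have hle_sup (j : Fin K) : c j ≤ ⨆ j, c j := le_ciSup (Set.finite_range c).bddAbove j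
  obtain ⟨j₀, hj₀⟩ := exists_eq_ciInf_of_finite (f := c)
  have hpos : 0 < ⨅ j, c j := hj₀ ▸ hc j₀
  have hR : 1 ≤ (⨆ j, c j) / ⨅ j, c j := (one_le_div hpos).2 (hj₀ ▸ hle_sup j₀)
  obtain ⟨j, hj⟩ := exists_eq_ciInf_of_finite (f := fun k => c k * (minHorizon k₀
    (Fintype.card (D₀ × Fin K)) ((⨆ j, c j) / ⨅ j, c j) δ δbar ε (σ2 k) : ℝ))
  obtain ⟨hT, hhorizon⟩ := minHorizon_spec (δbar := δbar) (ε := ε) hk h1 (hσ j) hcard hR hδ hδ1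
  rw [← hj]
  exact exists_isSchedule hcard hk h1 hσ hc hsub hε hδ hδ1 hδbar hε1 hε2 hpos hR j
    ((hle_sup j).trans_eq (div_mul_cancel₀ _ hpos.ne').symm) hT hhorizon

end Assembly

section Lift

variable {D₀ : Type*} {K : ℕ} {Ω : Type*} [MeasurableSpace Ω] {P : Measure Ω}
  {k₀ : D₀ → D₀ → ℝ} {f₀ : D₀ → Ω → ℝ} {w : ℕ → Ω → ℝ}

theorem IsCenteredGP.comp_fst (h : IsCenteredGP k₀ f₀ P) :
    IsCenteredGP (fun p q : D₀ × Fin K => k₀ p.1 q.1) (fun p => f₀ p.1) P where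
  measurable p := h.measurable p.1
  gaussian := h.gaussian.comp_right Prod.fst
  mean_zero p := h.mean_zero p.1
  covariance p q := h.covariance p.1 q.1

theorem IsStdNoise.comp_fst (h : IsStdNoise w f₀ P) :
    IsStdNoise w (fun p : D₀ × Fin K => f₀ p.1) P where
  measurable := h.measurable
  gaussian := h.gaussian
  indep := h.indep
  indep_f := h.indep_f.comp (φ := id) (ψ := fun (v : D₀ → ℝ) (p : D₀ × Fin K) => v p.1)
    measurable_id (by fun_prop)

end Lift

end TruVaR

theorem corollary3 {D₀ : Type*} [Fintype D₀] [Nonempty D₀] (K : ℕ) (hK : 0 < K)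
    (hcard : 2 ≤ Fintype.card (D₀ × Fin K))
    -- the kernel on the points, the noise variances and the costs
    (k₀ : D₀ → D₀ → ℝ) (hpsd : (Matrix.of k₀).PosSemidef) (hnorm : ∀ x, k₀ x x = 1)
    (σ2 : Fin K → ℝ) (hσ2 : ∀ k, 0 < σ2 k)
    (c : Fin K → ℝ) (hc : ∀ k, 0 < c k)
    (hsub : TruVaR.SubmodularVarReduction
      (fun p q : D₀ × Fin K => k₀ p.1 q.1) (fun p => σ2 p.2))
    -- the accuracy, the error probability and the slack parameter
    (ε : ℝ) (hε : 0 < ε) (δ : ℝ) (hδ : 0 < δ) (hδ1 : δ < 1)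
    (δbar : ℝ) (hδbar : 0 < δbar)
    (hε1 : ε ≤ 4 * (1 + δbar)) (hε2 : δbar * ε ≤ 4 * (1 + δbar)) :
    ∃ β : ℕ → ℝ, (∃ b > 0, ∀ i, b ≤ β i) ∧
      ∀ (task : TruVaR.Task) (Ω : Type*) [MeasurableSpace Ω] (P : MeasureTheory.Measure Ω)
        [MeasureTheory.IsProbabilityMeasure P]
        (f₀ : D₀ → Ω → ℝ) (w : ℕ → Ω → ℝ) (x : ℕ → Ω → D₀ × Fin K) (y : ℕ → Ω → ℝ),
        TruVaR.IsCenteredGP k₀ f₀ P → TruVaR.IsStdNoise w f₀ P →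
        TruVaR.IsRun (TruVaR.chooseNoiseInput k₀ σ2 c task δbar β) (fun p => f₀ p.1) w x y →
        ENNReal.ofReal (1 - δ) ≤ P {ω | ∀ t : ℕ,
          (⨅ k, c k * (TruVaR.minHorizon k₀ (Fintype.card (D₀ × Fin K))
              ((⨆ j, c j) / (⨅ j, c j)) δ δbar ε (σ2 k) : ℝ))
            ≤ TruVaR.cumCost (fun p : D₀ × Fin K => c p.2) (fun s => x s ω) t →
          TruVaR.EpsAccurate (fun p : D₀ × Fin K => f₀ p.1 ω) ε
            ((TruVaR.chooseNoiseInput k₀ σ2 c task δbar β).state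
              (fun s => x s ω) (fun s => y s ω) t) task} := by
  have _ : Nonempty (Fin K) := ⟨⟨0, hK⟩⟩
  obtain ⟨β, C, F, m, hβ, hS⟩ :=
    TruVaR.exists_isSchedule_iInf hcard hpsd hnorm hσ2 hc hsub hε hδ hδ1 hδbar hε1 hε2
  refine ⟨β, ⟨20, by norm_num, hβ⟩, fun task Ω _ P _ f₀ w x y hf hw hrun => ?_⟩
  exact (hS task).ofReal_le_measure_epsAccurate
    (TruVaR.isAdmissible_chooseNoiseInput hpsd hnorm hσ2 hc hsub hδbar ⟨20, by norm_num, hβ⟩ task)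
    (fun p => ciInf_le (Set.finite_range c).bddBelow p.2) hδ hδ1 hf.comp_fst hw.comp_fst hrun
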